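/- **The calculus.** Fix an infinite set of base names, an infinite set $\mathcal A$ of ports, an infinite set of variables, a set of agent constants and a set of data. Let $\overline{\mathcal A}=\{\overline a : a\in\mathcal A\}$, $\mathcal L=\mathcal A\cup\overline{\mathcal A}$, $\overline{\overline a}=a$. An *ambient name* $m_A$ is a base name $m$ together with a tag $A\subseteq\mathcal L$. Ambient prefixes are $\mu::= in\;n_B\mid out\;n_B$, capabilities are $C::= x\mid\mu\mid\varepsilon\mid C.C'$ ($x$ a variable), and messages are capabilities, ambient names and data; a *value* is a message without variables. The terms of $\mathrm{CMC_b}$ are $$P,Q::= 0\mid D\mid C.P\mid a(z).P\mid \overline a(v).P\mid \tau.P\mid m_A[P]\mid P+Q\mid P\mid Q\mid(\nu m_A)P\mid(\nu l)P\mid P[f],$$ where $D$ is an agent constant, $a\in\mathcal A$, $z$ is a variable, $v$ a message, $l\in\mathcal L$, and $f:\mathcal L\to\mathcal L$ is a relabelling, $f(\overline l)=\overline{f(l)}$, extended by $f(\tau)=\tau$. Every constant has one defining equation $D\stackrel{def}{=}P$ (mutual recursion is allowed) with $P$ without free variables. $\mathrm{fn}(P)$ is the set of free ambient names of $P$; the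 free names of a constant are those of its recursively unfolded equation, and they are assumed to be finite in number. Terms are taken up to $\alpha$-conversion of restricted ambient names (within the same tag) and of input variables; a renaming applied to a constant acts on its free names, giving the constant with the correspondingly renamed equation. *Processes* are the terms without free variables. **Reduction semantics.** Structural congruence $\equiv$ is the least equivalence relation preserved by $(\nu m_A)$, $(\nu l)$, $\mid$, $[f]$, $n_B[\,]$, $C.$ and the action prefixes $a(z).$, $\overline a(v).$, $\tau.$ (it is not required to be preserved by $+$) such that: $\mid$ and $+$ are commutative and associative, $P\mid 0\equiv P$, $P+0\equiv P$; $D\equiv P$ if $D\stackrel{def}{=}P$; $(\nu n_B)(P\mid Q)\equiv P\mid(\nu n_B)Q$ if $n_B\notin\mathrm{fn}(P)$; $(\nu n_B)(m_A[P])\equiv m_A[(\nu n_B)P]$ if $n\ne m$; $(\nu n_B)(\nu m_A)P\equiv(\nu m_A)(\nu n_B)P$; $(\nu n_B)0\equiv0$; $\varepsilon.P\equiv P$. Reduction $\to$ is the least relation that is preserved by $(\nu n_B)$, $(\nu l)$, $\mid$ and $n_B[\,]$, is closed under $\equiv$ on both sides, and satisfies $$m_A[in\;n_B.P\mid Q]\mid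 n_B[R]\to n_B[m_A[P\mid Q]\mid R],\qquad n_B[m_A[out\;n_B.P\mid Q]\mid R]\to m_A[P\mid Q]\mid n_B[R].$$ **Transition semantics.** Actions are $\alpha::=a(v)\mid\overline a(v)\mid\tau$, and ambient actions are $\lambda::= enter\;n_B\mid move\;n_B\mid exit\;n_B\mid\mu$. An outcome $O$ is a process or a concretion $(\nu\tilde m)\langle P\rangle Q$ with $\tilde m$ a list of ambient names. Put $((\nu\tilde m)\langle P\rangle Q)\mid R=(\nu\tilde m)\langle P\rangle(Q\mid R)$ if $\tilde m\cap\mathrm{fn}(R)=\emptyset$, and let $(\nu u)((\nu\tilde m)\langle P\rangle Q)$ be $(\nu u\tilde m)\langle P\rangle Q$ if $u\in\mathrm{fn}(P)$ and $(\nu\tilde m)\langle P\rangle(\nu u)Q$ otherwise. $\equiv$ is extended to concretions with the same $\tilde m$ componentwise. The transition relations are the least ones satisfying: * $\mu.P\xrightarrow{\mu}P$; * if $P\xrightarrow{in\;n_B}P'$ then $m_A[P]\xrightarrow{enter\;n_B}\langle m_A[P']\rangle0$; if $P\xrightarrow{out\;n_B}P'$ then $m_A[P]\xrightarrow{exit\;n_B}\langle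 m_A[P']\rangle0$; and $n_B[P]\xrightarrow{move\;n_B}\langle P\rangle0$; * if $P\xrightarrow{enter\;n_B}(\nu\tilde p)\langle P'\rangle P''$ and $Q\xrightarrow{move\;n_B}(\nu\tilde q)\langle Q'\rangle Q''$ with $(\mathrm{fn}(P')\cup\mathrm{fn}(P''))\cap\tilde q=(\mathrm{fn}(Q')\cup\mathrm{fn}(Q''))\cap\tilde p=\emptyset$, then $P\mid Q\xrightarrow{\tau}(\nu\tilde p)(\nu\tilde q)(n_B[P'\mid Q']\mid P''\mid Q'')$; * if $P\xrightarrow{exit\;n_B}(\nu\tilde m)\langle P'\rangle P''$ with $(\mathrm{fn}(P')\cup\mathrm{fn}(P''))\cap\tilde m=\emptyset$, then $n_B[P]\xrightarrow{\tau}(\nu\tilde m)(P'\mid n_B[P''])$; * for $\ell$ an ambient action or $\tau$: if $P\xrightarrow{\ell}O$ then $P\mid Q\xrightarrow{\ell}O\mid Q$, and $(\nu u)P\xrightarrow{\ell}(\nu u)O$ for every ambient name $u$ that does not occur in $\ell$; * if $P\xrightarrow{\tau}P'$ then $n_A[P]\xrightarrow{\tau}n_A[P']$; * if $P\equiv Q$,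 $Q\xrightarrow{\ell}O'$ and $O'\equiv O$ then $P\xrightarrow{\ell}O$, for every label $\ell$; * $a(z).P\xrightarrow{a(v)}P\{v/z\}$ for values $v$ (capture-avoiding, and only capabilities are put in capability position), $\overline a(v).P\xrightarrow{\overline a(v)}P$, $\tau.P\xrightarrow{\tau}P$; * if $P\xrightarrow{\alpha}P'$ then: $(\nu l)P\xrightarrow{\alpha}(\nu l)P'$ unless $\alpha$ is a communication on the port of $l$; $P+Q\xrightarrow{\alpha}P'$; $P\mid Q\xrightarrow{\alpha}P'\mid Q$; $P[f]\xrightarrow{f(\alpha)}P'[f]$; $D\xrightarrow{\alpha}P'$ if $D\stackrel{def}{=}P$; and $m_A[P]\xrightarrow{\alpha}m_A[P']$ if $\alpha$ is $a(v)$ or $\overline a(v)$ with $a\in A$; * if $P\xrightarrow{a(v)}P'$ and $Q\xrightarrow{\overline a(v)}Q'$ then $P\mid Q\xrightarrow{\tau}P'\mid Q'$. **Theorem.** Let $T'$ be the set of processes of $\mathrm{CMC_b}$ in which action prefixes ($a(z).$, $\overline a(v).$, $\tau.$), choice and relabelling occur neither in the term nor in the defining equations of the constants on which it depends. Then (a)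 for all $P,P'\in T'$ with $P\to P'$ there is $Q\in T'$ with $P\xrightarrow{\tau}Q$ and $Q\equiv P'$; (b) for all $P,R\in T'$ with $P\xrightarrow{\tau}R$ we have $P\to R$. -/

import Mathlib

universe u

/-- The basic carriers of the calculus: base names of ambients, ports, variables, agent constants
(other than the deadlocked agent), and data values that may be communicated besides capabilities
and ambient names. -/
structure Sig where
  Base : Type u
  Port : Type u
  Var : Type u
  Const : Type u
  Datum : Type u
  [infBase : Infinite Base]
  [infPort : Infinite Port]
  [infVar : Infinite Var]

namespace CMC

/-- Visible port labels: a port name `a` or its co-name. -/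
inductive Label (S : Sig.{u}) : Type u
  | name (a : S.Port)
  | coname (a : S.Port)

def Label.bar {S : Sig.{u}} : Label S → Label S
  | .name a => .coname a
  | .coname a => .name a

def Label.port {S : Sig.{u}} : Label S → S.Port
  | .name a => a
  | .coname a => a

/-- An ambient name `m_A`: a base name `m` tagged with the set `A` of port labels on which the
ambient may communicate. -/
@[ext]
structure AmbName (S : Sig.{u}) : Type u where
  base : S.Base
  ports : Set (Label S)

/-- Ambient prefixes `in n_B` and `out n_B`. -/
inductive Mu (S : Sig.{u}) : Type u
  | inn (n : AmbName S)
  | out (n : AmbName S)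

/-- Capabilities `C ::= x | μ | ε | C.C'`. -/
inductive Cap (S : Sig.{u}) : Type u
  | var (x : S.Var)
  | mu (m : Mu S)
  | eps
  | seq (c d : Cap S)

/-- Messages. A message variable `x` is `cap (var x)`. -/
inductive Msg (S : Sig.{u}) : Type u
  | cap (c : Cap S)
  | amb (n : AmbName S)
  | datum (d : S.Datum)

/-- Relabelling functions: they commute with complementation (and fix `τ`). -/
structure Relabelling (S : Sig.{u}) : Type u where
  toFun : Label S → Label S
  map_bar : ∀ l, toFun l.bar = (toFun l).bar

/-- Renamings of ambient names: permutations that keep the port tags. -/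
def Ren (S : Sig.{u}) : Subgroup (Equiv.Perm (AmbName S)) where
  carrier := {π | ∀ n, (π n).ports = n.ports}
  mul_mem' := by
    intro a b ha hb n
    show (a (b n)).ports = n.ports
    rw [ha, hb]
  one_mem' := fun _ => rfl
  inv_mem' := by
    intro a ha n
    have h := ha (a⁻¹ n)
    simpa using h.symm

open Classical in
/-- The renaming that exchanges two names with the same tag. -/
noncomputable def Ren.swap {S : Sig.{u}} (n k : AmbName S) (h : k.ports = n.ports) : Ren S :=
  ⟨Equiv.swap n k, by
    intro m
    by_cases h1 : m = n
    · subst h1; simpa using h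
    · by_cases h2 : m = k
      · subst h2; simpa using h.symm
      · rw [Equiv.swap_apply_of_ne_of_ne h1 h2]⟩

/-- Process terms. An agent constant carries a renaming, which is what α-conversion of an
enclosing restricted ambient name leaves on it: `const D π` is the constant whose defining equation
is that of `D` with `π` applied to its ambient names; the plain constant is `const D 1`. Renamings
that agree on the free names of `D` give structurally congruent terms. -/
inductive Proc (S : Sig.{u}) : Type u
  | nil
  | const (D : S.Const) (π : Ren S)
  | cap (c : Cap S) (P : Proc S)
  | inp (a : S.Port) (z : S.Var) (P : Proc S)
  | out (a : S.Port) (m : Msg S) (P : Proc S)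
  | tau (P : Proc S)
  | amb (n : AmbName S) (P : Proc S)
  | sum (P Q : Proc S)
  | par (P Q : Proc S)
  | nu (n : AmbName S) (P : Proc S)
  | nuPort (l : Label S) (P : Proc S)
  | rel (P : Proc S) (f : Relabelling S)

section Basic

variable {S : Sig.{u}}

/-! ### Ambient names occurring in prefixes, and renaming of ambient names -/

def Mu.amb : Mu S → AmbName S
  | .inn n => n
  | .out n => n

def Cap.names : Cap S → Set (AmbName S)
  | .var _ => ∅
  | .mu m => {m.amb}
  | .eps => ∅
  | .seq c d => c.names ∪ d.names

def Msg.names : Msg S → Set (AmbName S)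
  | .cap c => c.names
  | .amb n => {n}
  | .datum _ => ∅

def Mu.rename (π : Ren S) : Mu S → Mu S
  | .inn n => .inn (π.1 n)
  | .out n => .out (π.1 n)

def Cap.rename (π : Ren S) : Cap S → Cap S
  | .var x => .var x
  | .mu m => .mu (m.rename π)
  | .eps => .eps
  | .seq c d => .seq (c.rename π) (d.rename π)

def Msg.rename (π : Ren S) : Msg S → Msg S
  | .cap c => .cap (c.rename π)
  | .amb n => .amb (π.1 n)
  | .datum d => .datum d

def Proc.rename (π : Ren S) : Proc S → Proc S
  | .nil => .nil
  | .const D ρ => .const D (π * ρ)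
  | .cap c P => .cap (c.rename π) (P.rename π)
  | .inp a z P => .inp a z (P.rename π)
  | .out a m P => .out a (m.rename π) (P.rename π)
  | .tau P => .tau (P.rename π)
  | .amb n P => .amb (π.1 n) (P.rename π)
  | .sum P Q => .sum (P.rename π) (Q.rename π)
  | .par P Q => .par (P.rename π) (Q.rename π)
  | .nu n P => .nu (π.1 n) (P.rename π)
  | .nuPort l P => .nuPort l (P.rename π)
  | .rel P f => .rel (P.rename π) f

/-! ### Variables: free variables, renaming of variables, substitution of values -/

def Cap.fv : Cap S → Set S.Var
  | .var x => {x}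
  | .mu _ => ∅
  | .eps => ∅
  | .seq c d => c.fv ∪ d.fv

def Msg.fv : Msg S → Set S.Var
  | .cap c => c.fv
  | .amb _ => ∅
  | .datum _ => ∅

/-- Free variables; agent constants are closed. -/
def Proc.fv : Proc S → Set S.Var
  | .nil => ∅
  | .const _ _ => ∅
  | .cap c P => c.fv ∪ P.fv
  | .inp _ z P => P.fv \ {z}
  | .out _ m P => m.fv ∪ P.fv
  | .tau P => P.fv
  | .amb _ P => P.fv
  | .sum P Q => P.fv ∪ Q.fv
  | .par P Q => P.fv ∪ Q.fv
  | .nu _ P => P.fv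
  | .nuPort _ P => P.fv
  | .rel P _ => P.fv

def Cap.renVar (σ : Equiv.Perm S.Var) : Cap S → Cap S
  | .var x => .var (σ x)
  | .mu m => .mu m
  | .eps => .eps
  | .seq c d => .seq (c.renVar σ) (d.renVar σ)

def Msg.renVar (σ : Equiv.Perm S.Var) : Msg S → Msg S
  | .cap c => .cap (c.renVar σ)
  | .amb n => .amb n
  | .datum d => .datum d

def Proc.renVar (σ : Equiv.Perm S.Var) : Proc S → Proc S
  | .nil => .nil
  | .const D ρ => .const D ρ
  | .cap c P => .cap (c.renVar σ) (P.renVar σ)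
  | .inp a z P => .inp a (σ z) (P.renVar σ)
  | .out a m P => .out a (m.renVar σ) (P.renVar σ)
  | .tau P => .tau (P.renVar σ)
  | .amb n P => .amb n (P.renVar σ)
  | .sum P Q => .sum (P.renVar σ) (Q.renVar σ)
  | .par P Q => .par (P.renVar σ) (Q.renVar σ)
  | .nu n P => .nu n (P.renVar σ)
  | .nuPort l P => .nuPort l (P.renVar σ)
  | .rel P f => .rel (P.renVar σ) f

/-- Values are closed messages. -/
def Msg.IsValue (v : Msg S) : Prop := v.fv = ∅

open Classical in
/-- Substitution of a value for a variable in a capability. Only capabilities are substituted in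
capability position; see `Proc.Admits`. -/
noncomputable def Cap.subst (z : S.Var) (v : Msg S) : Cap S → Cap S
  | .var x =>
      match v with
      | .cap d => if x = z then d else .var x
      | _ => .var x
  | .mu m => .mu m
  | .eps => .eps
  | .seq c d => .seq (c.subst z v) (d.subst z v)

open Classical in
noncomputable def Msg.subst (z : S.Var) (v : Msg S) : Msg S → Msg S
  | .cap (.var x) => if x = z then v else .cap (.var x)
  | .cap c => .cap (c.subst z v)
  | .amb n => .amb n
  | .datum d => .datum d

open Classical in
/-- `P{v/z}` for a value `v`. It is meant for `P` with `P.Admits z v`, so that nothing is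
captured; other `P` have to be α-converted first. -/
noncomputable def Proc.subst (z : S.Var) (v : Msg S) : Proc S → Proc S
  | .nil => .nil
  | .const D ρ => .const D ρ
  | .cap c P => .cap (c.subst z v) (P.subst z v)
  | .inp a y P => if y = z then .inp a y P else .inp a y (P.subst z v)
  | .out a m P => .out a (m.subst z v) (P.subst z v)
  | .tau P => .tau (P.subst z v)
  | .amb n P => .amb n (P.subst z v)
  | .sum P Q => .sum (P.subst z v) (Q.subst z v)
  | .par P Q => .par (P.subst z v) (Q.subst z v)
  | .nu n P => .nu n (P.subst z v)
  | .nuPort l P => .nuPort l (P.subst z v)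
  | .rel P f => .rel (P.subst z v) f

def Cap.Admits (z : S.Var) (v : Msg S) (c : Cap S) : Prop :=
  z ∈ c.fv → ∃ d, v = .cap d

def Msg.Admits (z : S.Var) (v : Msg S) : Msg S → Prop
  | .cap (.var _) => True
  | .cap c => c.Admits z v
  | .amb _ => True
  | .datum _ => True

/-- `v` can be put for `z` in the term: no restricted ambient name captures a name of `v`, and
only capabilities are put in capability position. -/
def Proc.Admits (z : S.Var) (v : Msg S) : Proc S → Prop
  | .nil => True
  | .const _ _ => True
  | .cap c P => c.Admits z v ∧ P.Admits z v
  | .inp _ y P => y = z ∨ P.Admits z v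
  | .out _ m P => m.Admits z v ∧ P.Admits z v
  | .tau P => P.Admits z v
  | .amb _ P => P.Admits z v
  | .sum P Q => P.Admits z v ∧ Q.Admits z v
  | .par P Q => P.Admits z v ∧ Q.Admits z v
  | .nu n P => (z ∈ P.fv → n ∉ v.names) ∧ P.Admits z v
  | .nuPort _ P => P.Admits z v
  | .rel P _ => P.Admits z v

/-! ### Free ambient names -/

/-- `FreeIn body n P`: the ambient name `n` occurs free in `P`, where the free names of an agent
constant are those of its (recursively unfolded) defining equation. -/
inductive FreeIn (body : S.Const → Proc S) : AmbName S → Proc S → Prop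
  | const {D : S.Const} {π : Ren S} {n : AmbName S} :
      FreeIn body n (body D) → FreeIn body (π.1 n) (.const D π)
  | cap_here {c : Cap S} {P : Proc S} {n : AmbName S} : n ∈ c.names → FreeIn body n (.cap c P)
  | cap {c : Cap S} {P : Proc S} {n : AmbName S} : FreeIn body n P → FreeIn body n (.cap c P)
  | inp {a : S.Port} {z : S.Var} {P : Proc S} {n : AmbName S} :
      FreeIn body n P → FreeIn body n (.inp a z P)
  | out_here {a : S.Port} {m : Msg S} {P : Proc S} {n : AmbName S} :
      n ∈ m.names → FreeIn body n (.out a m P)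
  | out {a : S.Port} {m : Msg S} {P : Proc S} {n : AmbName S} :
      FreeIn body n P → FreeIn body n (.out a m P)
  | tau {P : Proc S} {n : AmbName S} : FreeIn body n P → FreeIn body n (.tau P)
  | amb_here {P : Proc S} {n : AmbName S} : FreeIn body n (.amb n P)
  | amb {m : AmbName S} {P : Proc S} {n : AmbName S} : FreeIn body n P → FreeIn body n (.amb m P)
  | sum_left {P Q : Proc S} {n : AmbName S} : FreeIn body n P → FreeIn body n (.sum P Q)
  | sum_right {P Q : Proc S} {n : AmbName S} : FreeIn body n Q → FreeIn body n (.sum P Q)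
  | par_left {P Q : Proc S} {n : AmbName S} : FreeIn body n P → FreeIn body n (.par P Q)
  | par_right {P Q : Proc S} {n : AmbName S} : FreeIn body n Q → FreeIn body n (.par P Q)
  | nu {m : AmbName S} {P : Proc S} {n : AmbName S} :
      n ≠ m → FreeIn body n P → FreeIn body n (.nu m P)
  | nuPort {l : Label S} {P : Proc S} {n : AmbName S} :
      FreeIn body n P → FreeIn body n (.nuPort l P)
  | rel {P : Proc S} {f : Relabelling S} {n : AmbName S} : FreeIn body n P → FreeIn body n (.rel P f)

end Basic

/-- A system of (possibly mutually recursive) defining equations `D = body D`, one for each agent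
constant. The right-hand sides are closed terms with finitely many free ambient names, those of the
unfolded constants included. -/
structure Equations (S : Sig.{u}) : Type u where
  body : S.Const → Proc S
  closed : ∀ D, (body D).fv = ∅
  finite_free : ∀ D, {n | FreeIn body n (body D)}.Finite

variable {S : Sig.{u}}

/-- The set of free ambient names of a process. -/
def fn (E : Equations S) (P : Proc S) : Set (AmbName S) := {n | FreeIn E.body n P}

/-! ### Reduction semantics -/

open Classical in
/-- Structural congruence; terms are also identified up to α-conversion of restricted ambient names
and of input variables. -/
inductive StrCong (E : Equations S) : Proc S → Proc S → Prop
  -- equivalence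
  | refl (P : Proc S) : StrCong E P P
  | symm {P Q : Proc S} : StrCong E P Q → StrCong E Q P
  | trans {P Q R : Proc S} : StrCong E P Q → StrCong E Q R → StrCong E P R
  -- contextuality
  | nu_congr (n : AmbName S) {P Q : Proc S} : StrCong E P Q → StrCong E (.nu n P) (.nu n Q)
  | nuPort_congr (l : Label S) {P Q : Proc S} :
      StrCong E P Q → StrCong E (.nuPort l P) (.nuPort l Q)
  | par_congr {P P' Q Q' : Proc S} :
      StrCong E P P' → StrCong E Q Q' → StrCong E (.par P Q) (.par P' Q')
  | rel_congr (f : Relabelling S) {P Q : Proc S} : StrCong E P Q → StrCong E (.rel P f) (.rel Q f)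
  | amb_congr (n : AmbName S) {P Q : Proc S} : StrCong E P Q → StrCong E (.amb n P) (.amb n Q)
  | cap_congr (c : Cap S) {P Q : Proc S} : StrCong E P Q → StrCong E (.cap c P) (.cap c Q)
  | inp_congr (a : S.Port) (z : S.Var) {P Q : Proc S} :
      StrCong E P Q → StrCong E (.inp a z P) (.inp a z Q)
  | out_congr (a : S.Port) (m : Msg S) {P Q : Proc S} :
      StrCong E P Q → StrCong E (.out a m P) (.out a m Q)
  | tau_congr {P Q : Proc S} : StrCong E P Q → StrCong E (.tau P) (.tau Q)
  -- axioms
  | par_comm (P Q : Proc S) : StrCong E (.par P Q) (.par Q P)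
  | par_assoc (P Q R : Proc S) : StrCong E (.par (.par P Q) R) (.par P (.par Q R))
  | zero_par (P : Proc S) : StrCong E (.par P .nil) P
  | sum_comm (P Q : Proc S) : StrCong E (.sum P Q) (.sum Q P)
  | sum_assoc (P Q R : Proc S) : StrCong E (.sum (.sum P Q) R) (.sum P (.sum Q R))
  | zero_sum (P : Proc S) : StrCong E (.sum P .nil) P
  | const (D : S.Const) (π : Ren S) : StrCong E (.const D π) ((E.body D).rename π)
  | res_par (n : AmbName S) (P Q : Proc S) (h : n ∉ fn E P) :
      StrCong E (.nu n (.par P Q)) (.par P (.nu n Q))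
  | res_amb (n m : AmbName S) (P : Proc S) (h : n.base ≠ m.base) :
      StrCong E (.nu n (.amb m P)) (.amb m (.nu n P))
  | res_res (n m : AmbName S) (P : Proc S) : StrCong E (.nu n (.nu m P)) (.nu m (.nu n P))
  | zero_res (n : AmbName S) : StrCong E (.nu n .nil) .nil
  | epsilon (P : Proc S) : StrCong E (.cap .eps P) P
  -- α-conversion
  | alpha (n k : AmbName S) (P : Proc S) (ht : k.ports = n.ports) (h : k ∉ fn E P) :
      StrCong E (.nu n P) (.nu k (P.rename (Ren.swap n k ht)))
  | const_ren (D : S.Const) (π ρ : Ren S) (h : ∀ n ∈ fn E (E.body D), π.1 n = ρ.1 n) :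
      StrCong E (.const D π) (.const D ρ)
  | alpha_inp (a : S.Port) (z y : S.Var) (P : Proc S) (h : y ∉ P.fv) :
      StrCong E (.inp a z P) (.inp a y (P.renVar (Equiv.swap z y)))

/-- The reduction relation. -/
inductive Red (E : Equations S) : Proc S → Proc S → Prop
  | red_in (m n : AmbName S) (P Q R : Proc S) :
      Red E (.par (.amb m (.par (.cap (.mu (.inn n)) P) Q)) (.amb n R))
        (.amb n (.par (.amb m (.par P Q)) R))
  | red_out (m n : AmbName S) (P Q R : Proc S) :
      Red E (.amb n (.par (.amb m (.par (.cap (.mu (.out n)) P) Q)) R))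
        (.par (.amb m (.par P Q)) (.amb n R))
  | struct {P Q Q' P' : Proc S} :
      StrCong E P Q → Red E Q Q' → StrCong E Q' P' → Red E P P'
  | nu (n : AmbName S) {P P' : Proc S} : Red E P P' → Red E (.nu n P) (.nu n P')
  | nuPort (l : Label S) {P P' : Proc S} : Red E P P' → Red E (.nuPort l P) (.nuPort l P')
  | par_left {P P' : Proc S} (Q : Proc S) : Red E P P' → Red E (.par P Q) (.par P' Q)
  | par_right {P P' : Proc S} (Q : Proc S) : Red E P P' → Red E (.par Q P) (.par Q P')
  | amb (n : AmbName S) {P P' : Proc S} : Red E P P' → Red E (.amb n P) (.amb n P')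

/-! ### Labelled transition semantics -/

/-- Actions `α`: a communication on a port label (`comm (name a) v` is the input `a(v)`,
`comm (coname a) v` the output of `v` on `a`), or the silent action. -/
inductive Act (S : Sig.{u}) : Type u
  | comm (l : Label S) (v : Msg S)
  | tau

/-- Labels of transitions: actions `α` and the ambient actions `λ`. -/
inductive TLabel (S : Sig.{u}) : Type u
  | act (α : Act S)
  | enter (n : AmbName S)
  | move (n : AmbName S)
  | exit (n : AmbName S)
  | mu (m : Mu S)

/-- The silent label. -/
abbrev TLabel.tau : TLabel S := .act .tau

/-- The label is an ambient action `λ` or `τ`. -/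
def TLabel.IsAmbOrTau : TLabel S → Prop
  | .act (.comm _ _) => False
  | _ => True

/-- The ambient names of a label. -/
def TLabel.names : TLabel S → Set (AmbName S)
  | .act (.comm _ v) => v.names
  | .act .tau => ∅
  | .enter n => {n}
  | .move n => {n}
  | .exit n => {n}
  | .mu m => {m.amb}

/-- The port `a` does not occur in the action. -/
def Act.Avoids (a : S.Port) : Act S → Prop
  | .comm l _ => l.port ≠ a
  | .tau => True

def Act.relabel (f : Relabelling S) : Act S → Act S
  | .comm l v => .comm (f.toFun l) v
  | .tau => .tau

/-- Outcomes of transitions: processes, and concretions `(ν ms)⟨P⟩Q`, where `P` is the part that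
moves, `Q` the part that stays behind, and `ms` lists private names that they share. -/
inductive Outcome (S : Sig.{u}) : Type u
  | proc (P : Proc S)
  | conc (ms : List (AmbName S)) (P Q : Proc S)

/-- The restriction `(ν ms)P` of a list of ambient names. -/
def nus (ms : List (AmbName S)) (P : Proc S) : Proc S := ms.foldr Proc.nu P

def Outcome.priv : Outcome S → List (AmbName S)
  | .proc _ => []
  | .conc ms _ _ => ms

/-- `O | R`, meant for `R` in which no private name of `O` is free. -/
def Outcome.par : Outcome S → Proc S → Outcome S
  | .proc P, R => .proc (.par P R)
  | .conc ms P Q, R => .conc ms P (.par Q R)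

open Classical in
/-- `(ν u)O`. -/
noncomputable def Outcome.nu (E : Equations S) (u : AmbName S) : Outcome S → Outcome S
  | .proc P => .proc (.nu u P)
  | .conc ms P Q => if u ∈ fn E P then .conc (u :: ms) P Q else .conc ms P (.nu u Q)

/-- Structural congruence of outcomes. -/
inductive OutCong (E : Equations S) : Outcome S → Outcome S → Prop
  | proc {P P' : Proc S} : StrCong E P P' → OutCong E (.proc P) (.proc P')
  | conc (ms : List (AmbName S)) {P P' Q Q' : Proc S} :
      StrCong E P P' → StrCong E Q Q' → OutCong E (.conc ms P Q) (.conc ms P' Q')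

/-- The transition relations `P –ℓ→ O`. The private names of an outcome are selected by
α-converting the source, with the rule `struct`. -/
inductive Trans (E : Equations S) : Proc S → TLabel S → Outcome S → Prop
  -- mobility
  | act_mu (m : Mu S) (P : Proc S) : Trans E (.cap (.mu m) P) (.mu m) (.proc P)
  | enter (m n : AmbName S) {P P' : Proc S} :
      Trans E P (.mu (.inn n)) (.proc P') →
      Trans E (.amb m P) (.enter n) (.conc [] (.amb m P') .nil)
  | co_enter (n : AmbName S) (P : Proc S) : Trans E (.amb n P) (.move n) (.conc [] P .nil)
  | tau_in (n : AmbName S) (ps qs : List (AmbName S)) {P P' P'' Q Q' Q'' : Proc S} :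
      Trans E P (.enter n) (.conc ps P' P'') → Trans E Q (.move n) (.conc qs Q' Q'') →
      (∀ q ∈ qs, q ∉ fn E P' ∪ fn E P'') → (∀ p ∈ ps, p ∉ fn E Q' ∪ fn E Q'') →
      Trans E (.par P Q) .tau
        (.proc (nus ps (nus qs (.par (.par (.amb n (.par P' Q')) P'') Q''))))
  | exit (m n : AmbName S) {P P' : Proc S} :
      Trans E P (.mu (.out n)) (.proc P') →
      Trans E (.amb m P) (.exit n) (.conc [] (.amb m P') .nil)
  | tau_out (n : AmbName S) (ms : List (AmbName S)) {P P' P'' : Proc S} :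
      Trans E P (.exit n) (.conc ms P' P'') →
      (∀ m ∈ ms, m ∉ fn E P' ∪ fn E P'') →
      Trans E (.amb n P) .tau (.proc (nus ms (.par P' (.amb n P''))))
  -- other operators
  | lam_par {P : Proc S} {ℓ : TLabel S} {O : Outcome S} (Q : Proc S) :
      ℓ.IsAmbOrTau → Trans E P ℓ O → (∀ m ∈ O.priv, m ∉ fn E Q) →
      Trans E (.par P Q) ℓ (O.par Q)
  | lam_res {P : Proc S} {ℓ : TLabel S} {O : Outcome S} (u : AmbName S) :
      ℓ.IsAmbOrTau → Trans E P ℓ O → u ∉ ℓ.names →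
      Trans E (.nu u P) ℓ (O.nu E u)
  | tau_amb (n : AmbName S) {P P' : Proc S} :
      Trans E P .tau (.proc P') → Trans E (.amb n P) .tau (.proc (.amb n P'))
  | struct {P Q : Proc S} {ℓ : TLabel S} {O' O : Outcome S} :
      StrCong E P Q → Trans E Q ℓ O' → OutCong E O' O → Trans E P ℓ O
  -- communication
  | inp (a : S.Port) (z : S.Var) (P : Proc S) (v : Msg S) :
      v.IsValue → P.Admits z v →
      Trans E (.inp a z P) (.act (.comm (.name a) v)) (.proc (P.subst z v))
  | out (a : S.Port) (v : Msg S) (P : Proc S) :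
      Trans E (.out a v P) (.act (.comm (.coname a) v)) (.proc P)
  | act_tau (P : Proc S) : Trans E (.tau P) .tau (.proc P)
  | res_act (l : Label S) {α : Act S} {P P' : Proc S} :
      Trans E P (.act α) (.proc P') → α.Avoids l.port →
      Trans E (.nuPort l P) (.act α) (.proc (.nuPort l P'))
  | sum {α : Act S} {P P' : Proc S} (Q : Proc S) :
      Trans E P (.act α) (.proc P') → Trans E (.sum P Q) (.act α) (.proc P')
  | par_com (a : S.Port) (v : Msg S) {P P' Q Q' : Proc S} :
      Trans E P (.act (.comm (.name a) v)) (.proc P') →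
      Trans E Q (.act (.comm (.coname a) v)) (.proc Q') →
      Trans E (.par P Q) .tau (.proc (.par P' Q'))
  | par_act {α : Act S} {P P' : Proc S} (Q : Proc S) :
      Trans E P (.act α) (.proc P') → Trans E (.par P Q) (.act α) (.proc (.par P' Q))
  | rel (f : Relabelling S) {α : Act S} {P P' : Proc S} :
      Trans E P (.act α) (.proc P') → Trans E (.rel P f) (.act (α.relabel f)) (.proc (.rel P' f))
  | const (D : S.Const) (π : Ren S) {α : Act S} {P' : Proc S} :
      Trans E ((E.body D).rename π) (.act α) (.proc P') →
      Trans E (.const D π) (.act α) (.proc P')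
  | global_com (n : AmbName S) (l : Label S) (v : Msg S) {P P' : Proc S} :
      Trans E P (.act (.comm l v)) (.proc P') → Label.name l.port ∈ n.ports →
      Trans E (.amb n P) (.act (.comm l v)) (.proc (.amb n P'))

/-! ### The sub-calculus without action prefixing, choice and relabelling -/

/-- The term uses no action prefix, no choice and no relabelling, and no constants outside `K`. -/
def Proc.Uses (K : Set S.Const) : Proc S → Prop
  | .nil => True
  | .const D _ => D ∈ K
  | .cap _ P => P.Uses K
  | .inp _ _ _ => False
  | .out _ _ _ => False
  | .tau _ => False
  | .amb _ P => P.Uses K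
  | .sum _ _ => False
  | .par P Q => P.Uses K ∧ Q.Uses K
  | .nu _ P => P.Uses K
  | .nuPort _ P => P.Uses K
  | .rel _ _ => False

/-- Processes (closed terms) of the sub-calculus: neither the term nor the defining equations of
the constants on which it depends use an action prefix, choice or relabelling. -/
def InSub (E : Equations S) (P : Proc S) : Prop :=
  P.fv = ∅ ∧ ∃ K : Set S.Const, (∀ D ∈ K, (E.body D).Uses K) ∧ P.Uses K

end CMC

namespace CMC

variable {S : Sig.{u}} {E : Equations S}

/-! ### Renaming -/

/-! A reduction becomes a τ-transition by induction (`Red.trans`): both reduction axioms arise from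
`enter`, `exit` and `move` transitions without private names, the surplus copies of 0 are absorbed
by `≡`, and every closure rule of `→` has a counterpart for `–τ→`. Since transitions are closed
under `≡`, the outcome is the reduct itself.

For the converse, each ambient transition is read back as a normal form of its source up to `≡`. If
`P –μ→ P'`, then `P ≡ (ν ks)(μ.A | B)` and `P' ≡ (ν ks)(A | B)` (`Fires`). If an ambient enters or
exits, then `P ≡ (ν ms)(k[A] | P'')`, where `A` fires the prefix to some `A'` and `k[A']` is the
moving part (`Leaves`). A `move n` transition gives `P ≡ (ν ms)(n[P'] | P'')` (`Splits`). Two such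
forms meeting in `tau_in`, or one inside an ambient in `tau_out`, are brought to a redex by scope
extrusion, after α-conversion to fresh base names (`exists_refresh`). `Trans.justified` collects
these facts in one induction on transitions.

The obstacle is that `T'` is not closed under `≡`: for instance `P ≡ P + 0`, and constants may be
folded in. The induction therefore uses a weaker property that `≡` preserves: the unfolding has no
action prefix, no relabelling, and no choice between two nontrivial sums (the negation of
`Communicating`). Communications are then impossible, and the only choices left are with inert sums,
which `≡` erases or which have no transitions (`Active`). -/

theorem Mu.rename_amb (π : Ren S) (m : Mu S) : (m.rename π).amb = π.1 m.amb := by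
  cases m <;> rfl

theorem Mu.rename_eq_self {π : Ren S} {m : Mu S} (h : π.1 m.amb = m.amb) : m.rename π = m := by
  cases m with
  | inn n => exact congrArg Mu.inn h
  | out n => exact congrArg Mu.out h

theorem Mu.rename_one (m : Mu S) : m.rename 1 = m := Mu.rename_eq_self rfl

theorem Mu.rename_rename (π ρ : Ren S) (m : Mu S) :
    (m.rename π).rename ρ = m.rename (ρ * π) := by
  cases m <;> rfl

theorem Cap.rename_one (c : Cap S) : c.rename 1 = c := by
  induction c with
  | mu m => exact congrArg Cap.mu m.rename_one
  | seq c d hc hd => simp only [Cap.rename, hc, hd]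
  | _ => rfl

theorem Cap.rename_rename (π ρ : Ren S) (c : Cap S) :
    (c.rename π).rename ρ = c.rename (ρ * π) := by
  induction c with
  | mu m => exact congrArg Cap.mu (m.rename_rename π ρ)
  | seq c d hc hd => simp only [Cap.rename, hc, hd]
  | _ => rfl

theorem Msg.rename_one (m : Msg S) : m.rename 1 = m := by
  cases m with
  | cap c => exact congrArg Msg.cap c.rename_one
  | _ => rfl

theorem Msg.rename_rename (π ρ : Ren S) (m : Msg S) :
    (m.rename π).rename ρ = m.rename (ρ * π) := by
  cases m with
  | cap c => exact congrArg Msg.cap (c.rename_rename π ρ)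
  | _ => rfl

theorem Proc.rename_one (P : Proc S) : P.rename 1 = P := by
  induction P with
  | amb n P ih => exact congrArg (Proc.amb n) ih
  | nu n P ih => exact congrArg (Proc.nu n) ih
  | _ => simp_all [Proc.rename, Cap.rename_one, Msg.rename_one]

theorem Proc.rename_rename (π ρ : Ren S) (P : Proc S) :
    (P.rename π).rename ρ = P.rename (ρ * π) := by
  induction P with
  | amb n P ih => exact congrArg (Proc.amb _) ih
  | nu n P ih => exact congrArg (Proc.nu _) ih
  | _ => simp_all [Proc.rename, Cap.rename_rename, Msg.rename_rename, mul_assoc]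

theorem Proc.rename_inv_rename (π : Ren S) (P : Proc S) : (P.rename π).rename π⁻¹ = P := by
  rw [rename_rename, inv_mul_cancel, rename_one]

theorem Cap.mem_names_rename (π : Ren S) {c : Cap S} {n : AmbName S} (h : n ∈ c.names) :
    π.1 n ∈ (c.rename π).names := by
  induction c with
  | mu m =>
    have h' : n = m.amb := h
    subst h'
    exact (m.rename_amb π).symm
  | seq c d hc hd => exact h.imp hc hd
  | _ => exact h.elim

theorem Msg.mem_names_rename (π : Ren S) {m : Msg S} {n : AmbName S} (h : n ∈ m.names) :
    π.1 n ∈ (m.rename π).names := by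
  cases m with
  | cap c => exact Cap.mem_names_rename π h
  | amb k => exact congrArg π.1 h
  | datum d => exact h.elim

theorem Ren.swap_apply_of_ne {n k m : AmbName S} (h : k.ports = n.ports) (hn : m ≠ n)
    (hk : m ≠ k) : (Ren.swap n k h).1 m = m := by
  classical exact Equiv.swap_apply_of_ne_of_ne hn hk

/-! ### Free names -/

theorem mem_fn_const {D : S.Const} {π : Ren S} {n : AmbName S} :
    n ∈ fn E (.const D π) ↔ ∃ k ∈ fn E (E.body D), π.1 k = n := by
  constructor
  · intro h; cases h with | const h => exact ⟨_, h, rfl⟩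
  · rintro ⟨k, h, rfl⟩; exact .const h

@[simp] theorem mem_fn_nil {n : AmbName S} : n ∈ fn E .nil ↔ False :=
  ⟨fun h => (nomatch h), False.elim⟩

@[simp] theorem mem_fn_cap {c : Cap S} {P : Proc S} {n : AmbName S} :
    n ∈ fn E (.cap c P) ↔ n ∈ c.names ∨ n ∈ fn E P := by
  constructor
  · intro h
    cases h with
    | cap_here h => exact .inl h
    | cap h => exact .inr h
  · rintro (h | h)
    exacts [.cap_here h, .cap h]

@[simp] theorem mem_fn_inp {a : S.Port} {z : S.Var} {P : Proc S} {n : AmbName S} :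
    n ∈ fn E (.inp a z P) ↔ n ∈ fn E P :=
  ⟨fun h => by cases h with | inp h => exact h, .inp⟩

@[simp] theorem mem_fn_out {a : S.Port} {m : Msg S} {P : Proc S} {n : AmbName S} :
    n ∈ fn E (.out a m P) ↔ n ∈ m.names ∨ n ∈ fn E P := by
  constructor
  · intro h
    cases h with
    | out_here h => exact .inl h
    | out h => exact .inr h
  · rintro (h | h)
    exacts [FreeIn.out_here h, FreeIn.out h]

@[simp] theorem mem_fn_tau {P : Proc S} {n : AmbName S} :
    n ∈ fn E (.tau P) ↔ n ∈ fn E P :=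
  ⟨fun h => by cases h with | tau h => exact h, .tau⟩

@[simp] theorem mem_fn_amb {m : AmbName S} {P : Proc S} {n : AmbName S} :
    n ∈ fn E (.amb m P) ↔ n = m ∨ n ∈ fn E P := by
  constructor
  · intro h
    cases h with
    | amb_here => exact .inl rfl
    | amb h => exact .inr h
  · rintro (rfl | h)
    exacts [.amb_here, .amb h]

@[simp] theorem mem_fn_sum {P Q : Proc S} {n : AmbName S} :
    n ∈ fn E (.sum P Q) ↔ n ∈ fn E P ∨ n ∈ fn E Q := by
  constructor
  · intro h
    cases h with
    | sum_left h => exact .inl h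
    | sum_right h => exact .inr h
  · rintro (h | h)
    exacts [.sum_left h, .sum_right h]

@[simp] theorem mem_fn_par {P Q : Proc S} {n : AmbName S} :
    n ∈ fn E (.par P Q) ↔ n ∈ fn E P ∨ n ∈ fn E Q := by
  constructor
  · intro h
    cases h with
    | par_left h => exact .inl h
    | par_right h => exact .inr h
  · rintro (h | h)
    exacts [.par_left h, .par_right h]

@[simp] theorem mem_fn_nu {m : AmbName S} {P : Proc S} {n : AmbName S} :
    n ∈ fn E (.nu m P) ↔ n ≠ m ∧ n ∈ fn E P :=
  ⟨fun h => by cases h with | nu h h' => exact ⟨h, h'⟩, fun h => .nu h.1 h.2⟩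

@[simp] theorem mem_fn_nuPort {l : Label S} {P : Proc S} {n : AmbName S} :
    n ∈ fn E (.nuPort l P) ↔ n ∈ fn E P :=
  ⟨fun h => by cases h with | nuPort h => exact h, .nuPort⟩

@[simp] theorem mem_fn_rel {f : Relabelling S} {P : Proc S} {n : AmbName S} :
    n ∈ fn E (.rel P f) ↔ n ∈ fn E P :=
  ⟨fun h => by cases h with | rel h => exact h, .rel⟩

theorem Cap.finite_names (c : Cap S) : c.names.Finite := by
  induction c with
  | mu m => exact Set.finite_singleton _
  | seq c d hc hd => exact hc.union hd
  | _ => exact Set.finite_empty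

theorem Msg.finite_names (m : Msg S) : m.names.Finite := by
  cases m with
  | cap c => exact c.finite_names
  | amb n => exact Set.finite_singleton _
  | datum d => exact Set.finite_empty

/-- This finiteness is what provides fresh names for α-conversion. For constants it is an assumption
on the equations. -/
theorem finite_fn (E : Equations S) (P : Proc S) : (fn E P).Finite := by
  induction P with
  | nil => exact Set.finite_empty.subset fun n h => (mem_fn_nil.1 h).elim
  | const D π => exact ((E.finite_free D).image π.1).subset fun n h => mem_fn_const.1 h
  | cap c P ih => exact (c.finite_names.union ih).subset fun n h => mem_fn_cap.1 h
  | inp a z P ih => exact ih.subset fun n h => mem_fn_inp.1 h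
  | out a m P ih => exact (m.finite_names.union ih).subset fun n h => mem_fn_out.1 h
  | tau P ih => exact ih.subset fun n h => mem_fn_tau.1 h
  | amb m P ih => exact ((Set.finite_singleton m).union ih).subset fun n h => mem_fn_amb.1 h
  | sum P Q hP hQ => exact (hP.union hQ).subset fun n h => mem_fn_sum.1 h
  | par P Q hP hQ => exact (hP.union hQ).subset fun n h => mem_fn_par.1 h
  | nu m P ih => exact ih.subset fun n h => (mem_fn_nu.1 h).2
  | nuPort l P ih => exact ih.subset fun n h => mem_fn_nuPort.1 h
  | rel P f ih => exact ih.subset fun n h => mem_fn_rel.1 h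

theorem mem_fn_rename_of_mem (π : Ren S) {P : Proc S} {n : AmbName S} (h : n ∈ fn E P) :
    π.1 n ∈ fn E (P.rename π) := by
  induction P generalizing n with
  | nil => exact (mem_fn_nil.1 h).elim
  | const D ρ =>
    obtain ⟨k, hk, rfl⟩ := mem_fn_const.1 h
    exact mem_fn_const.2 ⟨k, hk, rfl⟩
  | cap c P ih => exact mem_fn_cap.2 ((mem_fn_cap.1 h).imp (Cap.mem_names_rename π) ih)
  | inp a z P ih => exact mem_fn_inp.2 (ih (mem_fn_inp.1 h))
  | out a m P ih => exact mem_fn_out.2 ((mem_fn_out.1 h).imp (Msg.mem_names_rename π) ih)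
  | tau P ih => exact mem_fn_tau.2 (ih (mem_fn_tau.1 h))
  | amb m P ih => exact mem_fn_amb.2 ((mem_fn_amb.1 h).imp (congrArg π.1) ih)
  | sum P Q hP hQ => exact mem_fn_sum.2 ((mem_fn_sum.1 h).imp hP hQ)
  | par P Q hP hQ => exact mem_fn_par.2 ((mem_fn_par.1 h).imp hP hQ)
  | nu m P ih => exact mem_fn_nu.2 ((mem_fn_nu.1 h).imp (fun hn he => hn (π.1.injective he)) ih)
  | nuPort l P ih => exact mem_fn_nuPort.2 (ih (mem_fn_nuPort.1 h))
  | rel P f ih => exact mem_fn_rel.2 (ih (mem_fn_rel.1 h))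

theorem mem_fn_rename {π : Ren S} {P : Proc S} {n : AmbName S} :
    π.1 n ∈ fn E (P.rename π) ↔ n ∈ fn E P := by
  refine ⟨fun h => ?_, mem_fn_rename_of_mem π⟩
  have h' := mem_fn_rename_of_mem π⁻¹ h
  rw [Proc.rename_inv_rename] at h'
  have he : (π⁻¹).1 (π.1 n) = n := π.1.symm_apply_apply n
  rwa [he] at h'

theorem mem_fn_rename_iff {π : Ren S} {P : Proc S} {n : AmbName S} :
    n ∈ fn E (P.rename π) ↔ ∃ k ∈ fn E P, π.1 k = n := by
  constructor
  · intro h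
    refine ⟨π.1.symm n, ?_, π.1.apply_symm_apply n⟩
    rw [← mem_fn_rename (π := π), π.1.apply_symm_apply]
    exact h
  · rintro ⟨k, hk, rfl⟩
    exact mem_fn_rename.2 hk

theorem Cap.names_renVar (σ : Equiv.Perm S.Var) (c : Cap S) : (c.renVar σ).names = c.names := by
  induction c with
  | seq c d hc hd => simp only [Cap.renVar, Cap.names, hc, hd]
  | _ => rfl

theorem Msg.names_renVar (σ : Equiv.Perm S.Var) (m : Msg S) : (m.renVar σ).names = m.names := by
  cases m with
  | cap c => exact c.names_renVar σ
  | _ => rfl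

theorem mem_fn_renVar {σ : Equiv.Perm S.Var} {P : Proc S} {n : AmbName S} :
    n ∈ fn E (P.renVar σ) ↔ n ∈ fn E P := by
  induction P with
  | const D π => rfl
  | _ => simp_all [Proc.renVar, Cap.names_renVar, Msg.names_renVar]

/-- Lets the side conditions of scope extrusion be checked on any representative of a class. Folding
a constant is harmless because its free names are by definition those of its unfolding. -/
theorem StrCong.mem_fn {P Q : Proc S} (h : StrCong E P Q) (x : AmbName S) :
    x ∈ fn E P ↔ x ∈ fn E Q := by
  induction h with
  | refl => rfl
  | symm _ ih => exact ih.symm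
  | trans _ _ h₁ h₂ => exact h₁.trans h₂
  | const D π => rw [mem_fn_const, mem_fn_rename_iff]
  | res_par n P Q h =>
    have : x ∈ fn E P → x ≠ n := fun hx he => h (he ▸ hx)
    simp only [mem_fn_nu, mem_fn_par]; tauto
  | res_amb n m P h =>
    have : x = m → x ≠ n := fun hx he => h (by rw [← he, hx])
    simp only [mem_fn_nu, mem_fn_amb]; tauto
  | alpha n k P ht h =>
    simp only [mem_fn_nu, mem_fn_rename_iff]
    constructor
    · rintro ⟨hx, hP⟩
      have hk : x ≠ k := fun he => h (he ▸ hP)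
      exact ⟨hk, x, hP, Ren.swap_apply_of_ne ht hx hk⟩
    · rintro ⟨hx, y, hy, rfl⟩
      have hyk : y ≠ k := fun he => h (he ▸ hy)
      have hyn : y ≠ n := by
        rintro rfl
        exact hx (by classical exact Equiv.swap_apply_left _ _)
      rw [Ren.swap_apply_of_ne ht hyn hyk]
      exact ⟨hyn, hy⟩
  | const_ren D π ρ h =>
    simp only [mem_fn_const]
    exact exists_congr fun k => and_congr_right fun hk => by rw [h k hk]
  | alpha_inp a z y P h => simp only [mem_fn_inp, mem_fn_renVar]
  | _ => simp_all [Cap.names] <;> tauto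

/-! ### Restriction by a list of names -/

theorem mem_fn_nus {ms : List (AmbName S)} {P : Proc S} {n : AmbName S} :
    n ∈ fn E (nus ms P) ↔ n ∉ ms ∧ n ∈ fn E P := by
  induction ms with
  | nil => simp [nus]
  | cons m ms ih =>
    change n ∈ fn E (.nu m (nus ms P)) ↔ _
    rw [mem_fn_nu, ih, List.mem_cons]
    tauto

theorem StrCong.nus {P Q : Proc S} (ms : List (AmbName S)) (h : StrCong E P Q) :
    StrCong E (nus ms P) (nus ms Q) := by
  induction ms with
  | nil => exact h
  | cons m ms ih => exact .nu_congr m ih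

theorem Red.nus {P Q : Proc S} (ms : List (AmbName S)) (h : Red E P Q) :
    Red E (nus ms P) (nus ms Q) := by
  induction ms with
  | nil => exact h
  | cons m ms ih => exact .nu m ih

theorem StrCong.nus_par_right {ms : List (AmbName S)} {P : Proc S} (Q : Proc S)
    (h : ∀ m ∈ ms, m ∉ fn E P) :
    StrCong E (CMC.nus ms (.par P Q)) (.par P (CMC.nus ms Q)) := by
  induction ms with
  | nil => exact .refl _
  | cons m ms ih =>
    exact (StrCong.nu_congr m (ih fun k hk => h k (List.mem_cons_of_mem _ hk))).trans
      (.res_par m P _ (h m List.mem_cons_self))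

theorem StrCong.nus_par_left {ms : List (AmbName S)} (P : Proc S) {Q : Proc S}
    (h : ∀ m ∈ ms, m ∉ fn E Q) :
    StrCong E (CMC.nus ms (.par P Q)) (.par (CMC.nus ms P) Q) :=
  ((StrCong.par_comm P Q).nus ms).trans ((StrCong.nus_par_right P h).trans (.par_comm _ _))

theorem StrCong.nus_amb {ms : List (AmbName S)} {n : AmbName S} (P : Proc S)
    (h : ∀ m ∈ ms, m.base ≠ n.base) :
    StrCong E (CMC.nus ms (.amb n P)) (.amb n (CMC.nus ms P)) := by
  induction ms with
  | nil => exact .refl _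
  | cons m ms ih =>
    exact (StrCong.nu_congr m (ih fun k hk => h k (List.mem_cons_of_mem _ hk))).trans
      (.res_amb m n _ (h m List.mem_cons_self))

theorem StrCong.nu_nus (n : AmbName S) (ms : List (AmbName S)) (P : Proc S) :
    StrCong E (.nu n (CMC.nus ms P)) (CMC.nus ms (.nu n P)) := by
  induction ms with
  | nil => exact .refl _
  | cons m ms ih => exact (StrCong.res_res n m _).trans (.nu_congr m ih)

theorem StrCong.nus_nil (ms : List (AmbName S)) : StrCong E (CMC.nus ms .nil) .nil := by
  induction ms with
  | nil => exact .refl _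
  | cons m ms ih => exact (StrCong.nu_congr m ih).trans (.zero_res m)

/-- No axiom drops a vacuous restriction from a general term. Write `P` as `P | 0`, extrude `P` from
the scope, and discard the restrictions that remain around 0. -/
theorem StrCong.nus_of_notMem {ms : List (AmbName S)} {P : Proc S}
    (h : ∀ m ∈ ms, m ∉ fn E P) : StrCong E (CMC.nus ms P) P :=
  ((StrCong.zero_par P).symm.nus ms).trans ((StrCong.nus_par_right .nil h).trans
    ((StrCong.par_congr (.refl P) (.nus_nil ms)).trans (.zero_par P)))

theorem rename_nus_of_fixed {π : Ren S} {ms : List (AmbName S)} (h : ∀ m ∈ ms, π.1 m = m)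
    (P : Proc S) : (nus ms P).rename π = nus ms (P.rename π) := by
  induction ms with
  | nil => rfl
  | cons m ms ih =>
    change Proc.nu (π.1 m) ((nus ms P).rename π) = .nu m (nus ms (P.rename π))
    rw [h m List.mem_cons_self, ih fun k hk => h k (List.mem_cons_of_mem _ hk)]

/-- Restricted names can be α-converted simultaneously to names with bases outside a finite set. -/
theorem exists_refresh (E : Equations S) (ms : List (AmbName S)) (F : Set S.Base)
    (hF : F.Finite) :
    ∃ (ks : List (AmbName S)) (π : Ren S), (∀ k ∈ ks, k.base ∉ F) ∧
      (∀ n, n ∉ ms → n.base ∈ F → π.1 n = n) ∧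
      ∀ P : Proc S, (∀ n ∈ fn E P, n.base ∈ F) →
        StrCong E (nus ms P) (nus ks (P.rename π)) := by
  induction ms generalizing F with
  | nil =>
    exact ⟨[], 1, by simp, fun _ _ _ => rfl, fun P _ => by rw [P.rename_one]; exact .refl _⟩
  | cons m ms ih =>
    -- Enlarging `F` by `m.base` keeps the inner fresh names distinct from `m`, so the swap of `m`
    -- below does not disturb them. Bases rather than names are avoided because a restriction
    -- crosses an ambient only if the bases differ.
    obtain ⟨ks, π, hks, hπ, hP⟩ := ih (insert m.base F) (hF.insert _)
    have := S.infBase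
    have hfin : (insert m.base F ∪ AmbName.base '' {k | k ∈ ks}).Finite :=
      (hF.insert _).union ((List.finite_toSet ks).image _)
    obtain ⟨b, hb⟩ := hfin.exists_notMem
    have hbF : b ∉ insert m.base F := fun h => hb (.inl h)
    have hbks : ∀ k ∈ ks, k ≠ ⟨b, m.ports⟩ := fun k hk he =>
      hb (.inr ⟨k, hk, by rw [he]⟩)
    have hmks : ∀ k ∈ ks, k ≠ m := fun k hk he => hks k hk (by rw [he]; exact .inl rfl)
    refine ⟨⟨b, m.ports⟩ :: ks, Ren.swap m ⟨b, m.ports⟩ rfl * π, ?_, ?_, ?_⟩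
    · intro k hk
      rcases List.mem_cons.1 hk with rfl | hk
      · exact fun h => hbF (.inr h)
      · exact fun h => hks k hk (.inr h)
    · intro n hn hnF
      change (Ren.swap m ⟨b, m.ports⟩ rfl).1 (π.1 n) = n
      rw [hπ n (fun h => hn (List.mem_cons_of_mem _ h)) (.inr hnF)]
      refine Ren.swap_apply_of_ne (n := m) (k := ⟨b, m.ports⟩) rfl ?_ ?_
      · rintro rfl
        exact hn List.mem_cons_self
      · rintro rfl
        exact hbF (.inr hnF)
    · intro P hfn
      have h₁ := hP P fun n hn => .inr (hfn n hn)
      have hfresh : (⟨b, m.ports⟩ : AmbName S) ∉ fn E (nus ks (P.rename π)) := by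
        rw [← h₁.mem_fn, mem_fn_nus]
        exact fun h => hbF (.inr (hfn _ h.2))
      have h₂ := StrCong.alpha m ⟨b, m.ports⟩ _ rfl hfresh
      -- The swap moves only `m` and the new name, neither of which is in `ks`; it passes the inner
      -- restrictions and composes with `π`.
      rw [rename_nus_of_fixed fun k hk =>
        Ren.swap_apply_of_ne (n := m) (k := ⟨b, m.ports⟩) rfl (hmks k hk) (hbks k hk), Proc.rename_rename] at h₂
      exact (StrCong.nu_congr m h₁).trans h₂

/-! ### Normal forms of ambient actions -/

/-- `P` performs the ambient prefix `m` under some restrictions and becomes `P'`. -/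
def Fires (E : Equations S) (m : Mu S) (P P' : Proc S) : Prop :=
  ∃ (ks : List (AmbName S)) (A B : Proc S), m.amb ∉ ks ∧
    StrCong E P (nus ks (.par (.cap (.mu m) A) B)) ∧ StrCong E P' (nus ks (.par A B))

/-- One renaming is applied to both normal forms, so source and target still share `A` and `B`. It
fixes `m`, whose name is not among the restricted ones. -/
theorem Fires.refresh {m : Mu S} {P P' : Proc S} (h : Fires E m P P') {F : Set S.Base}
    (hF : F.Finite) :
    ∃ (ks : List (AmbName S)) (A B : Proc S), (∀ k ∈ ks, k.base ∉ F) ∧ m.amb ∉ ks ∧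
      StrCong E P (nus ks (.par (.cap (.mu m) A) B)) ∧ StrCong E P' (nus ks (.par A B)) := by
  obtain ⟨ms, A, B, hm, hP, hP'⟩ := h
  -- Besides `F`, the base of the prefix is included so that the prefix stays fixed, and the bases
  -- free in `A` and `B` because `exists_refresh` asks for them.
  set F' : Set S.Base := insert m.amb.base (F ∪ AmbName.base '' (fn E A ∪ fn E B)) with hF'
  have hfin : F'.Finite :=
    (hF.union (((finite_fn E A).union (finite_fn E B)).image _)).insert _
  obtain ⟨ks, π, hks, hπ, hcong⟩ := exists_refresh E ms F' hfin
  have hA : ∀ n ∈ fn E A, n.base ∈ F' := fun n hn => .inr (.inr ⟨n, .inl hn, rfl⟩)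
  have hB : ∀ n ∈ fn E B, n.base ∈ F' := fun n hn => .inr (.inr ⟨n, .inr hn, rfl⟩)
  have hmu : m.rename π = m := Mu.rename_eq_self (hπ _ hm (.inl rfl))
  refine ⟨ks, A.rename π, B.rename π, fun k hk h => hks k hk (.inr (.inl h)),
    fun h => hks _ h (.inl rfl), hP.trans ?_, hP'.trans (hcong _ ?_)⟩
  · have := hcong (.par (.cap (.mu m) A) B) ?_
    · simpa only [Proc.rename, Cap.rename, hmu] using this
    · intro n hn
      rcases mem_fn_par.1 hn with hn | hn
      · rcases mem_fn_cap.1 hn with hn | hn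
        · have hn' : n = m.amb := hn
          exact .inl (by rw [hn'])
        · exact hA n hn
      · exact hB n hn
  · intro n hn
    exact (mem_fn_par.1 hn).elim (hA n) (hB n)

theorem Fires.congr {m : Mu S} {P P' Q Q' : Proc S} (h : Fires E m Q Q') (hP : StrCong E P Q)
    (hP' : StrCong E Q' P') : Fires E m P P' := by
  obtain ⟨ks, A, B, hm, h₁, h₂⟩ := h
  exact ⟨ks, A, B, hm, hP.trans h₁, hP'.symm.trans h₂⟩

theorem Fires.prefix (m : Mu S) (P : Proc S) : Fires E m (.cap (.mu m) P) P :=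
  ⟨[], P, .nil, List.not_mem_nil, (StrCong.zero_par _).symm, (StrCong.zero_par _).symm⟩

theorem Fires.par {m : Mu S} {P P' : Proc S} (h : Fires E m P P') (Q : Proc S) :
    Fires E m (.par P Q) (.par P' Q) := by
  obtain ⟨ks, A, B, hks, hm, h₁, h₂⟩ := h.refresh ((finite_fn E Q).image AmbName.base)
  have hQ : ∀ k ∈ ks, k ∉ fn E Q := fun k hk hkQ => hks k hk ⟨k, hkQ, rfl⟩
  have key : ∀ X Y : Proc S, StrCong E X (nus ks (.par Y B)) →
      StrCong E (.par X Q) (nus ks (.par Y (.par B Q))) := fun X Y h =>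
    (StrCong.par_congr h (.refl Q)).trans
      ((StrCong.nus_par_left _ hQ).symm.trans ((StrCong.par_assoc _ _ _).nus ks))
  exact ⟨ks, A, .par B Q, hm, key _ _ h₁, key _ _ h₂⟩

theorem Fires.nu {m : Mu S} {P P' : Proc S} (h : Fires E m P P') {n : AmbName S}
    (hn : n ≠ m.amb) : Fires E m (.nu n P) (.nu n P') := by
  obtain ⟨ks, A, B, hm, h₁, h₂⟩ := h
  refine ⟨n :: ks, A, B, ?_, .nu_congr n h₁, .nu_congr n h₂⟩
  rw [List.mem_cons]
  rintro (h | h)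
  exacts [hn h.symm, hm h]

/-- Firing consumes only the prefix, so the only free name that can disappear is the one in it. This
gives the free-name clause of `Splits`. -/
theorem Fires.mem_fn {m : Mu S} {P P' : Proc S} (h : Fires E m P P') {n : AmbName S}
    (hn : n ∈ fn E P) : n = m.amb ∨ n ∈ fn E P' := by
  obtain ⟨ks, A, B, hm, h₁, h₂⟩ := h
  rw [h₁.mem_fn, mem_fn_nus, mem_fn_par, mem_fn_cap] at hn
  rw [h₂.mem_fn, mem_fn_nus, mem_fn_par]
  obtain ⟨hk, (h | h) | h⟩ := hn
  exacts [.inl h, .inr ⟨hk, .inl h⟩, .inr ⟨hk, .inr h⟩]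

/-- Once the restricted names are fresh for `m`, `n` and `R`, they can be pulled out of `m[ ]` and
over `n[R]`, which exposes the redex; after the reduction they are pushed back into `n[ ]` and `m[
]`. -/
theorem Fires.red_in {n : AmbName S} {P P' : Proc S} (h : Fires E (.inn n) P P') (m : AmbName S)
    (R : Proc S) : Red E (.par (.amb m P) (.amb n R)) (.amb n (.par (.amb m P') R)) := by
  obtain ⟨ks, A, B, hks, -, h₁, h₂⟩ := h.refresh (F := insert m.base (insert n.base
    (AmbName.base '' fn E R))) ((((finite_fn E R).image _).insert _).insert _)
  have hm : ∀ k ∈ ks, k.base ≠ m.base := fun k hk h => hks k hk (.inl h)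
  have hn : ∀ k ∈ ks, k.base ≠ n.base := fun k hk h => hks k hk (.inr (.inl h))
  have hR : ∀ k ∈ ks, k ∉ fn E R := fun k hk h => hks k hk (.inr (.inr ⟨k, h, rfl⟩))
  have hnR : ∀ k ∈ ks, k ∉ fn E (.amb n R) := fun k hk h =>
    (mem_fn_amb.1 h).elim (fun h => hn k hk (by rw [h])) (hR k hk)
  refine .struct ?_ ((Red.red_in m n A B R).nus ks) ?_
  · exact (StrCong.par_congr ((StrCong.amb_congr m h₁).trans (StrCong.nus_amb _ hm).symm)
      (.refl _)).trans (StrCong.nus_par_left _ hnR).symm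
  · exact (StrCong.nus_amb _ hn).trans (.amb_congr n ((StrCong.nus_par_left _ hR).trans
      (.par_congr ((StrCong.nus_amb _ hm).trans (.amb_congr m h₂.symm)) (.refl _))))

theorem Fires.red_out {n : AmbName S} {P P' : Proc S} (h : Fires E (.out n) P P')
    (m : AmbName S) (R : Proc S) :
    Red E (.amb n (.par (.amb m P) R)) (.par (.amb m P') (.amb n R)) := by
  obtain ⟨ks, A, B, hks, -, h₁, h₂⟩ := h.refresh (F := insert m.base (insert n.base
    (AmbName.base '' fn E R))) ((((finite_fn E R).image _).insert _).insert _)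
  have hm : ∀ k ∈ ks, k.base ≠ m.base := fun k hk h => hks k hk (.inl h)
  have hn : ∀ k ∈ ks, k.base ≠ n.base := fun k hk h => hks k hk (.inr (.inl h))
  have hR : ∀ k ∈ ks, k ∉ fn E R := fun k hk h => hks k hk (.inr (.inr ⟨k, h, rfl⟩))
  have hnR : ∀ k ∈ ks, k ∉ fn E (.amb n R) := fun k hk h =>
    (mem_fn_amb.1 h).elim (fun h => hn k hk (by rw [h])) (hR k hk)
  refine .struct ?_ ((Red.red_out m n A B R).nus ks) ?_
  · exact (StrCong.amb_congr n ((StrCong.par_congr ((StrCong.amb_congr m h₁).trans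
      (StrCong.nus_amb _ hm).symm) (.refl _)).trans (StrCong.nus_par_left _ hR).symm)).trans
      (StrCong.nus_amb _ hn).symm
  · exact (StrCong.nus_par_left _ hnR).trans
      (.par_congr ((StrCong.nus_amb _ hm).trans (.amb_congr m h₂.symm)) (.refl _))

/-- `P` is, up to structural congruence, `(ν ms)(A | P'')`, where `A` does not contain more free
names than `P'` and `n`, and `n` is not restricted. -/
def Splits (E : Equations S) (n : AmbName S) (P A : Proc S) (ms : List (AmbName S))
    (P' P'' : Proc S) : Prop :=
  n ∉ ms ∧ StrCong E P (nus ms (.par A P'')) ∧ ∀ x ∈ fn E A, x = n ∨ x ∈ fn E P'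

theorem Splits.congr {n : AmbName S} {P Q A P' P'' Q' Q'' : Proc S} {ms : List (AmbName S)}
    (h : Splits E n Q A ms Q' Q'') (hP : StrCong E P Q) (h' : StrCong E Q' P')
    (h'' : StrCong E Q'' P'') : Splits E n P A ms P' P'' :=
  ⟨h.1, hP.trans (h.2.1.trans ((StrCong.par_congr (.refl A) h'').nus ms)),
    fun x hx => (h.2.2 x hx).imp_right (h'.mem_fn x).1⟩

theorem Splits.par {n : AmbName S} {P A P' P'' : Proc S} {ms : List (AmbName S)}
    (h : Splits E n P A ms P' P'') {Q : Proc S} (hQ : ∀ m ∈ ms, m ∉ fn E Q) :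
    Splits E n (.par P Q) A ms P' (.par P'' Q) :=
  ⟨h.1, (StrCong.par_congr h.2.1 (.refl Q)).trans
    ((StrCong.nus_par_left _ hQ).symm.trans ((StrCong.par_assoc _ _ _).nus ms)), h.2.2⟩

theorem Splits.nu_mem {n u : AmbName S} {P A P' P'' : Proc S} {ms : List (AmbName S)}
    (h : Splits E n P A ms P' P'') (hu : u ≠ n) :
    Splits E n (.nu u P) A (u :: ms) P' P'' := by
  refine ⟨?_, .nu_congr u h.2.1, h.2.2⟩
  rw [List.mem_cons]
  rintro (h' | h')
  exacts [hu h'.symm, h.1 h']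

/-- A concretion keeps `u` on the residual when `u` is not free in the moving part `P'`. The
free-name clause then says that `u` is not free in `A` either, as `u ≠ n`, so the scope of `u` can
shrink to `P''`. -/
theorem Splits.nu_notMem {n u : AmbName S} {P A P' P'' : Proc S} {ms : List (AmbName S)}
    (h : Splits E n P A ms P' P'') (hu : u ≠ n) (hP' : u ∉ fn E P') :
    Splits E n (.nu u P) A ms P' (.nu u P'') :=
  ⟨h.1, (StrCong.nu_congr u h.2.1).trans ((StrCong.nu_nus u ms _).trans
    ((StrCong.res_par u A P'' fun hA => (h.2.2 u hA).elim hu hP').nus ms)), h.2.2⟩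

theorem Splits.of_conc_nil {n : AmbName S} {A P' : Proc S}
    (h : ∀ x ∈ fn E A, x = n ∨ x ∈ fn E P') : Splits E n A A [] P' .nil :=
  ⟨List.not_mem_nil, (StrCong.zero_par A).symm, h⟩

/-- The shape of a process and of an outcome of it in which an ambient leaves by the prefix
`m`. -/
def Leaves (E : Equations S) (m : Mu S) (P : Proc S) (ms : List (AmbName S))
    (P' P'' : Proc S) : Prop :=
  ∃ (k : AmbName S) (A A' : Proc S), Fires E m A A' ∧ StrCong E (.amb k A') P' ∧
    Splits E m.amb P (.amb k A) ms P' P''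

theorem Leaves.of_fires {m : Mu S} {P P' : Proc S} (h : Fires E m P P') (k : AmbName S) :
    Leaves E m (.amb k P) [] (.amb k P') .nil := by
  refine ⟨k, P, P', h, .refl _, .of_conc_nil fun x hx => ?_⟩
  rw [mem_fn_amb] at hx ⊢
  rcases hx with hx | hx
  · exact .inr (.inl hx)
  · exact (h.mem_fn hx).imp_right .inr

/-- The side conditions of `tau_in` speak of the outcomes. The free-name clause of `Splits` carries
them back to the sources, so that both lists of restrictions can be extruded in front of the redex.
-/
theorem Leaves.red_in {n : AmbName S} {ps qs : List (AmbName S)} {P P' P'' Q Q' Q'' : Proc S}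
    (hP : Leaves E (.inn n) P ps P' P'') (hQ : Splits E n Q (.amb n Q') qs Q' Q'')
    (hq : ∀ q ∈ qs, q ∉ fn E P' ∪ fn E P'') (hp : ∀ p ∈ ps, p ∉ fn E Q' ∪ fn E Q'') :
    Red E (.par P Q)
      (nus ps (nus qs (.par (.par (.amb n (.par P' Q')) P'') Q''))) := by
  obtain ⟨k, A, A', hA, hP', hnp, hPc, hfn⟩ := hP
  obtain ⟨hnq, hQc, -⟩ := hQ
  -- The source ambient of the second component also carries the name `n`; it is not in `ps` because
  -- labels never mention restricted names.
  have hps : ∀ p ∈ ps, p ∉ fn E (nus qs (.par (.amb n Q') Q'')) := by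
    intro p hpp h
    rw [mem_fn_nus, mem_fn_par, mem_fn_amb] at h
    obtain ⟨-, (h | h) | h⟩ := h
    · exact hnp (h ▸ hpp)
    · exact hp p hpp (.inl h)
    · exact hp p hpp (.inr h)
  have hqs : ∀ q ∈ qs, q ∉ fn E (.par (.amb k A) P'') := by
    intro q hqq h
    rcases mem_fn_par.1 h with h | h
    · rcases hfn q h with h | h
      · have h : q = n := h
        exact hnq (h ▸ hqq)
      · exact hq q hqq (.inl h)
    · exact hq q hqq (.inr h)
  have hsrc : StrCong E (.par P Q)
      (nus ps (nus qs (.par (.par (.amb k A) P'') (.par (.amb n Q') Q'')))) :=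
    (StrCong.par_congr hPc hQc).trans ((StrCong.nus_par_left _ hps).symm.trans
      ((StrCong.nus_par_right _ hqs).symm.nus ps))
  have hswap : StrCong E (.par (.par (.amb k A) P'') (.par (.amb n Q') Q''))
      (.par (.par (.par (.amb k A) (.amb n Q')) P'') Q'') :=
    (StrCong.par_assoc _ _ _).symm.trans (.par_congr ((StrCong.par_assoc _ _ _).trans
      ((StrCong.par_congr (.refl _) (.par_comm _ _)).trans (StrCong.par_assoc _ _ _).symm))
      (.refl _))
  refine .struct (hsrc.trans ((hswap.nus qs).nus ps))
    (((((hA.red_in k Q').par_left P'').par_left Q'').nus qs).nus ps) ?_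
  exact ((StrCong.par_congr (.par_congr (.amb_congr n (.par_congr hP' (.refl _))) (.refl _))
    (.refl _)).nus qs).nus ps

/-- The names `ms` may share their base with `n`, so they cannot simply be moved across `n[ ]`. The
side condition of `tau_out` makes these restrictions vacuous on both sides, and they are dropped
before the reduction and restored after it. -/
theorem Leaves.red_out {n : AmbName S} {ms : List (AmbName S)} {P P' P'' : Proc S}
    (hP : Leaves E (.out n) P ms P' P'') (hm : ∀ m ∈ ms, m ∉ fn E P' ∪ fn E P'') :
    Red E (.amb n P) (nus ms (.par P' (.amb n P''))) := by
  obtain ⟨k, A, A', hA, hP', hn, hPc, hfn⟩ := hP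
  have hsrc : ∀ m ∈ ms, m ∉ fn E (.par (.amb k A) P'') := by
    intro m hmm h
    rcases mem_fn_par.1 h with h | h
    · rcases hfn m h with h | h
      · have h : m = n := h
        exact hn (h ▸ hmm)
      · exact hm m hmm (.inl h)
    · exact hm m hmm (.inr h)
  have htgt : ∀ m ∈ ms, m ∉ fn E (.par P' (.amb n P'')) := by
    intro m hmm h
    rcases mem_fn_par.1 h with h | h
    · exact hm m hmm (.inl h)
    · rcases mem_fn_amb.1 h with h | h
      · exact hn (h ▸ hmm)
      · exact hm m hmm (.inr h)
  exact .struct (.amb_congr n (hPc.trans (.nus_of_notMem hsrc))) (hA.red_out k P'')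
    ((StrCong.par_congr hP' (.refl _)).trans (StrCong.nus_of_notMem htgt).symm)

theorem Leaves.congr {m : Mu S} {P Q P' P'' Q' Q'' : Proc S} {ms : List (AmbName S)}
    (h : Leaves E m Q ms Q' Q'') (hP : StrCong E P Q) (h' : StrCong E Q' P')
    (h'' : StrCong E Q'' P'') : Leaves E m P ms P' P'' := by
  obtain ⟨k, A, A', hA, hk, hs⟩ := h
  exact ⟨k, A, A', hA, hk.trans h', hs.congr hP h' h''⟩

theorem Leaves.par {m : Mu S} {P P' P'' : Proc S} {ms : List (AmbName S)}
    (h : Leaves E m P ms P' P'') {Q : Proc S} (hQ : ∀ k ∈ ms, k ∉ fn E Q) :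
    Leaves E m (.par P Q) ms P' (.par P'' Q) := by
  obtain ⟨k, A, A', hA, hk, hs⟩ := h
  exact ⟨k, A, A', hA, hk, hs.par hQ⟩

theorem Leaves.nu_mem {m : Mu S} {u : AmbName S} {P P' P'' : Proc S} {ms : List (AmbName S)}
    (h : Leaves E m P ms P' P'') (hu : u ≠ m.amb) :
    Leaves E m (.nu u P) (u :: ms) P' P'' := by
  obtain ⟨k, A, A', hA, hk, hs⟩ := h
  exact ⟨k, A, A', hA, hk, hs.nu_mem hu⟩

theorem Leaves.nu_notMem {m : Mu S} {u : AmbName S} {P P' P'' : Proc S} {ms : List (AmbName S)}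
    (h : Leaves E m P ms P' P'') (hu : u ≠ m.amb) (hP' : u ∉ fn E P') :
    Leaves E m (.nu u P) ms P' (.nu u P'') := by
  obtain ⟨k, A, A', hA, hk, hs⟩ := h
  exact ⟨k, A, A', hA, hk, hs.nu_notMem hu hP'⟩

/-! ### Inert processes, and processes with proper actions -/

/-- Sums all of whose summands are the deadlocked agent. -/
def NilSum : Proc S → Prop
  | .nil => True
  | .sum P Q => NilSum P ∧ NilSum Q
  | _ => False

/-- As `≡` is not assumed to pass under `+`, the summands of `Q` are re-associated to the top level
and removed there one by one. -/
theorem NilSum.sum_cong {Q : Proc S} (h : NilSum Q) (P : Proc S) : StrCong E (.sum P Q) P := by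
  induction Q generalizing P with
  | nil => exact .zero_sum P
  | sum Q R hQ hR =>
    exact (StrCong.sum_assoc P Q R).symm.trans ((hR h.2 _).trans (hQ h.1 P))
  | _ => exact h.elim

theorem NilSum.rename {P : Proc S} (h : NilSum P) (π : Ren S) : NilSum (P.rename π) := by
  induction P with
  | nil => trivial
  | sum P Q hP hQ => exact ⟨hP h.1, hQ h.2⟩
  | _ => exact h.elim

theorem nilSum_rename {P : Proc S} {π : Ren S} : NilSum (P.rename π) ↔ NilSum P :=
  ⟨fun h => by simpa only [Proc.rename_inv_rename] using h.rename π⁻¹, fun h => h.rename π⟩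

/-- The unfolding of the process has an ambient or a prefix other than `ε`. -/
inductive Active (E : Equations S) : Proc S → Prop
  | const {D : S.Const} {π : Ren S} : Active E (E.body D) → Active E (.const D π)
  | cap_here {c : Cap S} {P : Proc S} : c ≠ .eps → Active E (.cap c P)
  | cap {c : Cap S} {P : Proc S} : Active E P → Active E (.cap c P)
  | inp {a : S.Port} {z : S.Var} {P : Proc S} : Active E (.inp a z P)
  | out {a : S.Port} {m : Msg S} {P : Proc S} : Active E (.out a m P)
  | tau {P : Proc S} : Active E (.tau P)
  | amb {n : AmbName S} {P : Proc S} : Active E (.amb n P)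
  | sum_left {P Q : Proc S} : Active E P → Active E (.sum P Q)
  | sum_right {P Q : Proc S} : Active E Q → Active E (.sum P Q)
  | par_left {P Q : Proc S} : Active E P → Active E (.par P Q)
  | par_right {P Q : Proc S} : Active E Q → Active E (.par P Q)
  | nu {n : AmbName S} {P : Proc S} : Active E P → Active E (.nu n P)
  | nuPort {l : Label S} {P : Proc S} : Active E P → Active E (.nuPort l P)
  | rel {P : Proc S} {f : Relabelling S} : Active E P → Active E (.rel P f)

/-- The unfolding of the process has an action prefix, a relabelling, or a choice that is not
trivial. -/
inductive Communicating (E : Equations S) : Proc S → Prop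
  | const {D : S.Const} {π : Ren S} : Communicating E (E.body D) → Communicating E (.const D π)
  | cap {c : Cap S} {P : Proc S} : Communicating E P → Communicating E (.cap c P)
  | inp {a : S.Port} {z : S.Var} {P : Proc S} : Communicating E (.inp a z P)
  | out {a : S.Port} {m : Msg S} {P : Proc S} : Communicating E (.out a m P)
  | tau {P : Proc S} : Communicating E (.tau P)
  | amb {n : AmbName S} {P : Proc S} : Communicating E P → Communicating E (.amb n P)
  | sum_left {P Q : Proc S} : Communicating E P → Communicating E (.sum P Q)
  | sum_right {P Q : Proc S} : Communicating E Q → Communicating E (.sum P Q)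
  | sum {P Q : Proc S} : ¬ NilSum P → ¬ NilSum Q → Communicating E (.sum P Q)
  | par_left {P Q : Proc S} : Communicating E P → Communicating E (.par P Q)
  | par_right {P Q : Proc S} : Communicating E Q → Communicating E (.par P Q)
  | nu {n : AmbName S} {P : Proc S} : Communicating E P → Communicating E (.nu n P)
  | nuPort {l : Label S} {P : Proc S} : Communicating E P → Communicating E (.nuPort l P)
  | rel {P : Proc S} {f : Relabelling S} : Communicating E (.rel P f)

section Unfolding

variable {D : S.Const} {π : Ren S} {P Q : Proc S}

theorem active_const : Active E (.const D π) ↔ Active E (E.body D) :=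
  ⟨fun h => by cases h; assumption, .const⟩

theorem active_nil : ¬ Active E (.nil : Proc S) := fun h => nomatch h

theorem active_cap {c : Cap S} : Active E (.cap c P) ↔ c ≠ .eps ∨ Active E P :=
  ⟨fun h => by
    cases h with
    | cap_here h => exact .inl h
    | cap h => exact .inr h, fun h => h.elim .cap_here .cap⟩

theorem active_sum : Active E (.sum P Q) ↔ Active E P ∨ Active E Q :=
  ⟨fun h => by
    cases h with
    | sum_left h => exact .inl h
    | sum_right h => exact .inr h, fun h => h.elim .sum_left .sum_right⟩

theorem active_par : Active E (.par P Q) ↔ Active E P ∨ Active E Q :=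
  ⟨fun h => by
    cases h with
    | par_left h => exact .inl h
    | par_right h => exact .inr h, fun h => h.elim .par_left .par_right⟩

theorem active_nu {n : AmbName S} : Active E (.nu n P) ↔ Active E P :=
  ⟨fun h => by cases h; assumption, .nu⟩

theorem active_nuPort {l : Label S} : Active E (.nuPort l P) ↔ Active E P :=
  ⟨fun h => by cases h; assumption, .nuPort⟩

theorem active_rel {f : Relabelling S} : Active E (.rel P f) ↔ Active E P :=
  ⟨fun h => by cases h; assumption, .rel⟩

theorem communicating_const : Communicating E (.const D π) ↔ Communicating E (E.body D) :=
  ⟨fun h => by cases h; assumption, .const⟩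

theorem communicating_nil : ¬ Communicating E (.nil : Proc S) := fun h => nomatch h

theorem communicating_cap {c : Cap S} : Communicating E (.cap c P) ↔ Communicating E P :=
  ⟨fun h => by cases h; assumption, .cap⟩

theorem communicating_amb {n : AmbName S} : Communicating E (.amb n P) ↔ Communicating E P :=
  ⟨fun h => by cases h; assumption, .amb⟩

theorem communicating_sum : Communicating E (.sum P Q) ↔
    Communicating E P ∨ Communicating E Q ∨ ¬ NilSum P ∧ ¬ NilSum Q :=
  ⟨fun h => by
    cases h with
    | sum_left h => exact .inl h
    | sum_right h => exact .inr (.inl h)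
    | sum h h' => exact .inr (.inr ⟨h, h'⟩),
    fun h => h.elim .sum_left fun h => h.elim .sum_right fun h => .sum h.1 h.2⟩

theorem communicating_par :
    Communicating E (.par P Q) ↔ Communicating E P ∨ Communicating E Q :=
  ⟨fun h => by
    cases h with
    | par_left h => exact .inl h
    | par_right h => exact .inr h, fun h => h.elim .par_left .par_right⟩

theorem communicating_nu {n : AmbName S} : Communicating E (.nu n P) ↔ Communicating E P :=
  ⟨fun h => by cases h; assumption, .nu⟩

theorem communicating_nuPort {l : Label S} :
    Communicating E (.nuPort l P) ↔ Communicating E P :=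
  ⟨fun h => by cases h; assumption, .nuPort⟩

end Unfolding

theorem Cap.rename_eq_eps {π : Ren S} {c : Cap S} : c.rename π = .eps ↔ c = .eps := by
  cases c <;> simp [Cap.rename]

theorem active_rename {P : Proc S} {π : Ren S} : Active E (P.rename π) ↔ Active E P := by
  induction P with
  | nil => rfl
  | const D ρ => exact active_const.trans active_const.symm
  | cap c P ih => simp only [Proc.rename, active_cap, ih, ne_eq, Cap.rename_eq_eps]
  | inp a z P => exact iff_of_true .inp .inp
  | out a m P => exact iff_of_true .out .out
  | tau P => exact iff_of_true .tau .tau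
  | amb n P => exact iff_of_true .amb .amb
  | sum P Q hP hQ => simp only [Proc.rename, active_sum, hP, hQ]
  | par P Q hP hQ => simp only [Proc.rename, active_par, hP, hQ]
  | nu n P ih => simp only [Proc.rename, active_nu, ih]
  | nuPort l P ih => simp only [Proc.rename, active_nuPort, ih]
  | rel P f ih => simp only [Proc.rename, active_rel, ih]

theorem communicating_rename {P : Proc S} {π : Ren S} :
    Communicating E (P.rename π) ↔ Communicating E P := by
  induction P with
  | nil => rfl
  | const D ρ => exact communicating_const.trans communicating_const.symm
  | cap c P ih => simp only [Proc.rename, communicating_cap, ih]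
  | inp a z P => exact iff_of_true .inp .inp
  | out a m P => exact iff_of_true .out .out
  | tau P => exact iff_of_true .tau .tau
  | amb n P ih => simp only [Proc.rename, communicating_amb, ih]
  | sum P Q hP hQ => simp only [Proc.rename, communicating_sum, hP, hQ, nilSum_rename]
  | par P Q hP hQ => simp only [Proc.rename, communicating_par, hP, hQ]
  | nu n P ih => simp only [Proc.rename, communicating_nu, ih]
  | nuPort l P ih => simp only [Proc.rename, communicating_nuPort, ih]
  | rel P f => exact iff_of_true .rel .rel

/-- `NilSum` is syntactic and not invariant, since `0 | 0 ≡ 0`. `Active` is the invariant used to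
show that inert sums have no transitions, even after rewriting by `≡`. -/
theorem StrCong.active {P Q : Proc S} (h : StrCong E P Q) : Active E P ↔ Active E Q := by
  induction h with
  | refl => rfl
  | symm _ ih => exact ih.symm
  | trans _ _ h₁ h₂ => exact h₁.trans h₂
  | inp_congr | alpha_inp => exact iff_of_true .inp .inp
  | out_congr => exact iff_of_true .out .out
  | tau_congr => exact iff_of_true .tau .tau
  | amb_congr => exact iff_of_true .amb .amb
  | res_amb => exact iff_of_true (.nu .amb) .amb
  | _ =>
    simp_all only [active_nu, active_nuPort, active_par, active_rel, active_cap, active_sum,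
      active_nil, active_const, active_rename, ne_eq, not_true_eq_false, or_false, false_or]
    try tauto

/-- A choice counts only when both sides are nontrivial, so `P ≡ P + 0` is respected; for nested
sums this asks for two nontrivial summands, whatever the bracketing. As `≡` has no congruence rule
for `+`, the syntactic `NilSum` suffices here. -/
theorem StrCong.communicating {P Q : Proc S} (h : StrCong E P Q) :
    Communicating E P ↔ Communicating E Q := by
  induction h with
  | refl => rfl
  | symm _ ih => exact ih.symm
  | trans _ _ h₁ h₂ => exact h₁.trans h₂
  | inp_congr | alpha_inp => exact iff_of_true .inp .inp
  | out_congr => exact iff_of_true .out .out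
  | tau_congr => exact iff_of_true .tau .tau
  | rel_congr => exact iff_of_true .rel .rel
  | _ =>
    simp_all only [communicating_nu, communicating_nuPort, communicating_par, communicating_cap,
      communicating_amb, communicating_sum, communicating_nil, communicating_const,
      communicating_rename, NilSum]
    try tauto

theorem NilSum.not_active {P : Proc S} (h : NilSum P) : ¬ Active E P := by
  induction P with
  | nil => exact active_nil
  | sum P Q hP hQ => exact fun ha => (active_sum.1 ha).elim (hP h.1) (hQ h.2)
  | _ => exact h.elim

theorem Trans.active {P : Proc S} {ℓ : TLabel S} {O : Outcome S} (h : Trans E P ℓ O) :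
    Active E P := by
  induction h with
  | act_mu => exact .cap_here nofun
  | enter | co_enter | exit | tau_out | tau_amb | global_com => exact .amb
  | tau_in _ _ _ _ _ _ _ ih => exact .par_left ih
  | lam_par _ _ _ _ ih => exact .par_left ih
  | lam_res _ _ _ _ ih => exact .nu ih
  | struct h _ _ ih => exact h.active.2 ih
  | inp => exact .inp
  | out => exact .out
  | act_tau => exact .tau
  | res_act _ _ _ ih => exact .nuPort ih
  | sum _ _ ih => exact .sum_left ih
  | par_com _ _ _ _ ih => exact .par_left ih
  | par_act _ _ ih => exact .par_left ih
  | rel _ _ ih => exact .rel ih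
  | const _ _ _ ih => exact .const (active_rename.1 ih)

/-- The induction runs over the derivation of `Communicating`, not over the term, which copes with
recursive constants: unfolding one leads to a body that again uses only `K`. -/
theorem Proc.Uses.not_communicating {P : Proc S} {K : Set S.Const}
    (hK : ∀ D ∈ K, (E.body D).Uses K) (h : P.Uses K) : ¬ Communicating E P := by
  intro hc
  induction hc with
  | const _ ih => exact ih (hK _ h)
  | inp | out | tau | sum | rel | sum_left | sum_right => exact h
  | par_left _ ih => exact ih h.1
  | par_right _ ih => exact ih h.2
  | cap _ ih | amb _ ih | nu _ ih | nuPort _ ih => exact ih h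

/-! ### Transitions and reductions -/

theorem Red.trans {P P' : Proc S} (h : Red E P P') : Trans E P .tau (.proc P') := by
  induction h with
  | red_in m n P Q R =>
    have h₁ : Trans E (.amb m (.par (.cap (.mu (.inn n)) P) Q)) (.enter n)
        (.conc [] (.amb m (.par P Q)) .nil) :=
      .enter m n (Trans.lam_par (O := .proc P) Q trivial (.act_mu _ P)
        fun _ h => (List.not_mem_nil h).elim)
    exact .struct (.refl _) (.tau_in n [] [] h₁ (.co_enter n R)
      (fun _ h => (List.not_mem_nil h).elim) fun _ h => (List.not_mem_nil h).elim)
      (.proc ((StrCong.zero_par _).trans (.zero_par _)))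
  | red_out m n P Q R =>
    have h₁ : Trans E (.amb m (.par (.cap (.mu (.out n)) P) Q)) (.exit n)
        (.conc [] (.amb m (.par P Q)) .nil) :=
      .exit m n (Trans.lam_par (O := .proc P) Q trivial (.act_mu _ P)
        fun _ h => (List.not_mem_nil h).elim)
    have h₂ := Trans.lam_par (ℓ := .exit n) R trivial h₁ fun _ h => (List.not_mem_nil h).elim
    exact .struct (.refl _) (.tau_out n [] h₂ fun _ h => (List.not_mem_nil h).elim)
      -- The ambient that left has 0 as residual, so the body of `n` is now `0 | R`.
      (.proc (.par_congr (.refl _) (.amb_congr n ((StrCong.par_comm _ _).trans (.zero_par R)))))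
  | struct h _ h' ih => exact .struct h ih (.proc h')
  | nu n _ ih => exact Trans.lam_res (O := .proc _) n trivial ih fun h => h
  | nuPort l _ ih => exact .res_act l ih trivial
  | par_left Q _ ih => exact .par_act Q ih
  | par_right Q _ ih =>
    exact .struct (.par_comm _ _) (.par_act Q ih) (.proc (.par_comm _ _))
  | amb n _ ih => exact .tau_amb n ih

/-- What a transition with a given label and outcome says about its source. -/
def Justified (E : Equations S) (P : Proc S) : TLabel S → Outcome S → Prop
  | .act .tau, .proc R => ¬ Communicating E P → Red E P R
  | .act (.comm _ _), _ => Communicating E P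
  | .mu m, .proc R => Fires E m P R
  | .enter n, .conc ms P' P'' => Leaves E (.inn n) P ms P' P''
  | .exit n, .conc ms P' P'' => Leaves E (.out n) P ms P' P''
  | .move n, .conc ms P' P'' => Splits E n P (.amb n P') ms P' P''
  | _, _ => True

theorem Justified.par {P : Proc S} {ℓ : TLabel S} {O : Outcome S} (h : Justified E P ℓ O)
    {Q : Proc S} (hO : ∀ m ∈ O.priv, m ∉ fn E Q) : Justified E (.par P Q) ℓ (O.par Q) := by
  match ℓ, O, h with
  | .act .tau, .proc R, h => exact fun hc => (h fun hP => hc (.par_left hP)).par_left Q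
  | .act .tau, .conc _ _ _, _ => trivial
  | .act (.comm _ _), _, h => exact .par_left h
  | .mu m, .proc R, h => exact Fires.par h Q
  | .mu m, .conc _ _ _, _ => trivial
  | .enter n, .conc ms P' P'', h => exact Leaves.par h hO
  | .enter n, .proc _, _ => trivial
  | .exit n, .conc ms P' P'', h => exact Leaves.par h hO
  | .exit n, .proc _, _ => trivial
  | .move n, .conc ms P' P'', h => exact Splits.par h hO
  | .move n, .proc _, _ => trivial

theorem Justified.nu {P : Proc S} {ℓ : TLabel S} {O : Outcome S} (h : Justified E P ℓ O)
    {u : AmbName S} (hu : u ∉ ℓ.names) : Justified E (.nu u P) ℓ (O.nu E u) := by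
  match ℓ, O, h with
  | .act .tau, .proc R, h => exact fun hc => (h fun hP => hc (.nu hP)).nu u
  | .act .tau, .conc _ P' _, _ => by_cases hP : u ∈ fn E P' <;> simp [Outcome.nu, hP, Justified]
  | .act (.comm _ _), _, h => exact Communicating.nu h
  | .mu m, .proc R, h => exact Fires.nu h hu
  | .mu m, .conc _ P' _, _ => by_cases hP : u ∈ fn E P' <;> simp [Outcome.nu, hP, Justified]
  | .enter n, .conc ms P' P'', h =>
    by_cases hP : u ∈ fn E P'
    · rw [Outcome.nu, if_pos hP]; exact Leaves.nu_mem h hu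
    · rw [Outcome.nu, if_neg hP]; exact Leaves.nu_notMem h hu hP
  | .enter n, .proc _, _ => trivial
  | .exit n, .conc ms P' P'', h =>
    by_cases hP : u ∈ fn E P'
    · rw [Outcome.nu, if_pos hP]; exact Leaves.nu_mem h hu
    · rw [Outcome.nu, if_neg hP]; exact Leaves.nu_notMem h hu hP
  | .exit n, .proc _, _ => trivial
  | .move n, .conc ms P' P'', h =>
    by_cases hP : u ∈ fn E P'
    · rw [Outcome.nu, if_pos hP]; exact Splits.nu_mem h hu
    · rw [Outcome.nu, if_neg hP]; exact Splits.nu_notMem h hu hP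
  | .move n, .proc _, _ => trivial

/-- For the label `move n` the ambient split off must be literally `n[P']`. `Splits.congr` leaves it
unchanged while `P'` is rewritten, and this restores the match. -/
theorem Splits.moving_congr {n : AmbName S} {P P'' Q' P' : Proc S} {ms : List (AmbName S)}
    (h : Splits E n P (.amb n Q') ms P' P'') (hQ : StrCong E Q' P') :
    Splits E n P (.amb n P') ms P' P'' :=
  ⟨h.1, h.2.1.trans ((StrCong.par_congr (.amb_congr n hQ) (.refl _)).nus ms),
    fun _ hx => mem_fn_amb.1 hx⟩

theorem Justified.congr {P Q : Proc S} {ℓ : TLabel S} {O O' : Outcome S}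
    (h : Justified E Q ℓ O') (hP : StrCong E P Q) (hO : OutCong E O' O) : Justified E P ℓ O := by
  cases hO with
  | proc hR =>
    match ℓ, h with
    | .act .tau, h => exact fun hc => .struct hP (h fun hQ => hc (hP.communicating.2 hQ)) hR
    | .act (.comm _ _), h => exact hP.communicating.2 h
    | .mu m, h => exact Fires.congr h hP hR
    | .enter n, _ => trivial
    | .exit n, _ => trivial
    | .move n, _ => trivial
  | conc ms h' h'' =>
    match ℓ, h with
    | .act .tau, _ => trivial
    | .act (.comm _ _), h => exact hP.communicating.2 h
    | .mu m, _ => trivial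
    | .enter n, h => exact Leaves.congr h hP h' h''
    | .exit n, h => exact Leaves.congr h hP h' h''
    | .move n, h => exact (Splits.congr h hP h' h'').moving_congr h'

theorem Trans.justified {P : Proc S} {ℓ : TLabel S} {O : Outcome S} (h : Trans E P ℓ O) :
    Justified E P ℓ O := by
  induction h with
  | act_mu m P => exact Fires.prefix m P
  | enter m n _ ih => exact Leaves.of_fires ih m
  | exit m n _ ih => exact Leaves.of_fires ih m
  | co_enter n P => exact Splits.of_conc_nil fun _ hx => mem_fn_amb.1 hx
  | tau_in n ps qs _ _ hq hp hP hQ => exact fun _ => Leaves.red_in hP hQ hq hp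
  | tau_out n ms _ hm hP => exact fun _ => Leaves.red_out hP hm
  | lam_par Q _ _ hO ih => exact ih.par hO
  | lam_res u _ _ hu ih => exact ih.nu hu
  | tau_amb n _ ih => exact fun hc => (ih fun hP => hc (.amb hP)).amb n
  | struct hP _ hO ih => exact ih.congr hP hO
  | inp => exact .inp
  | out => exact .out
  | act_tau P => exact fun hc => (hc .tau).elim
  -- Only communications and τ pass a port restriction, so the normal forms of ambient actions need
  -- no restricted ports.
  | @res_act l α P P' _ _ ih =>
    cases α with
    | comm => exact .nuPort ih
    | tau => exact fun hc => (ih fun hP => hc (.nuPort hP)).nuPort l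
  | @sum α P P' Q hP ih =>
    cases α with
    | comm => exact .sum_left ih
    | tau =>
      intro hc
      -- Either `Q` is inert and `P + Q ≡ P`, or both summands are nontrivial, `P` because it has a
      -- transition, and the choice makes the source communicating.
      by_cases hQ : NilSum Q
      · exact .struct (hQ.sum_cong P) (ih fun hP => hc (.sum_left hP)) (.refl _)
      · exact (hc (.sum (fun h => h.not_active hP.active) hQ)).elim
  | par_com a v _ _ ih => exact fun hc => (hc (.par_left ih)).elim
  | par_act Q _ ih => exact Justified.par ih fun _ h => (List.not_mem_nil h).elim
  | @rel f α P P' _ ih =>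
    cases α with
    | comm => exact .rel
    | tau => exact fun hc => (hc .rel).elim
  -- A constant is structurally congruent to its unfolding, so this is an instance of closure under
  -- `≡`.
  | @const D π α P' _ ih => exact ih.congr (.const D π) (.proc (.refl P'))
  | global_com n l v _ _ ih => exact .amb ih

end CMC

theorem theorem1 (S : Sig.{u}) (E : CMC.Equations S) :
    (∀ P P' : CMC.Proc S, CMC.InSub E P → CMC.InSub E P' → CMC.Red E P P' →
      ∃ Q : CMC.Proc S, CMC.InSub E Q ∧
        CMC.Trans E P CMC.TLabel.tau (CMC.Outcome.proc Q) ∧ CMC.StrCong E Q P') ∧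
    (∀ P R : CMC.Proc S, CMC.InSub E P → CMC.InSub E R →
      CMC.Trans E P CMC.TLabel.tau (CMC.Outcome.proc R) → CMC.Red E P R) := by
  refine ⟨fun P P' _ hP' h => ⟨P', hP', h.trans, .refl P'⟩, ?_⟩
  rintro P R ⟨_, K, hK, hP⟩ - h
  exact h.justified (hP.not_communicating hK)
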